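/- A \emph{star-shaped set} of valence $n\ge 1$ and radius $r>0$ is the union of $n$ half-open segments of length $r$ glued at a common end point, its centre, with the path metric. A \emph{metric graph} is a compact connected metric space in which every point $p$ has a neighbourhood isometric to a star-shaped set with centre $p$. A \emph{tropical curve} is a connected space obtained from a metric graph by attaching finitely many unbounded edges, each isometric to $[0,\infty]$, at their end points $0$; that is, it is a compact connected Hausdorff space with an extended metric (compatible with the topology at finite distances) in which every point either has a star-shaped neighbourhood or is the infinite end of an unbounded edge $e\cong[0,\infty]$ with $e\setminus\{0\}$ open. Let $\Gamma$ be a metric graph or a tropical curve with a \emph{real structure}, i.e. an isometry $\iota:\Gamma\to\Gamma$ (a distance-preserving homeomorphism) with $\iota\circ\iota=\mathrm{id}$, and let $\Gamma(\mathbb R)=\{p\in\Gamma:\iota(p)=p\}$. A divisor $D=\sum_p D(p)\,p$ is a finite $\mathbb Z$-linear combination of points of $\Gamma$; it is \emph{real} if $D(\iota(p))=D(p)$ for all $p$. A \emph{rational function} on $\Gamma$ is a continuous function $f:\Gamma\to\mathbb R\cup\{\pm\infty\}$, with values $\pm\infty$ at most at infinite ends of unbounded edges, that is piecewise affine with integer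 slopes and finitely many pieces; $\Delta(f)(p)$ is the sum of the slopes of $f$ at $p$ in all directions emanating from $p$ (at an infinite end this is minus the slope of $f$ towards that end). Two divisors $D_1,D_2$ are \emph{linearly equivalent} if $D_2-D_1=\Delta(f)$ for some rational function $f$. Let $D_1,D_2$ be two linearly equivalent real divisors on $\Gamma$. Then for every connected component $\Gamma'$ of $\Gamma(\mathbb R)$, $$\deg(D_1|_{\Gamma'})\equiv\deg(D_2|_{\Gamma'})\pmod 2,$$ where $\deg(D|_{\Gamma'})=\sum_{p\in\Gamma'}D(p)$. -/

import Mathlib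

open Filter Topology
open scoped ENNReal

namespace RealTropical

/-!  The spaces below carry a topology together with an extended distance (`WeakEMetricSpace`):
the distance may take the value `∞`, and the topology is the metric one on each ball of finite
distance. An ordinary metric space is a special case, and so is `[0, ∞]` with its order topology
and its usual distance, for which `∞` is at distance `∞` from every other point.  -/

variable {T : Type*} [TopologicalSpace T] [WeakEMetricSpace T]

/-- `φ` is an isometry (with centre going to `p`) from the star-shaped set with `n ≥ 1` branches
`{0} ∪ ⋃ k, {k} × (0, r)`, endowed with its path metric, onto a neighbourhood of `p`:
`φ k t` is the point at distance `t` from the centre on the `k`-th branch. Only the values of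
`φ k` on `[0, r)` matter. -/
structure IsStarChart (p : T) {n : ℕ} (r : ℝ) (φ : Fin n → ℝ → T) : Prop where
  valence_pos : 0 < n
  radius_pos : 0 < r
  center : ∀ k, φ k 0 = p
  edist_same : ∀ k, ∀ s ∈ Set.Ico 0 r, ∀ t ∈ Set.Ico 0 r,
    edist (φ k s) (φ k t) = ENNReal.ofReal |s - t|
  edist_ne : ∀ k l, k ≠ l → ∀ s ∈ Set.Ico 0 r, ∀ t ∈ Set.Ico 0 r,
    edist (φ k s) (φ l t) = ENNReal.ofReal (s + t)
  mem_nhds : (⋃ k, φ k '' Set.Ico 0 r) ∈ 𝓝 p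

/-- `p` has a star-shaped neighbourhood centred at `p`. -/
def HasStarNeighbourhood (p : T) : Prop :=
  ∃ (n : ℕ) (r : ℝ) (φ : Fin n → ℝ → T), IsStarChart p r φ

/-- `φ` identifies an unbounded edge of `T` isometrically with `[0, ∞]`; the edge meets the closure
of its complement at most in its origin `φ 0`. -/
structure IsUnboundedEdge (φ : ℝ≥0∞ → T) : Prop where
  continuous : Continuous φ
  edist_eq : ∀ s t, edist (φ s) (φ t) = edist s t
  isOpen : IsOpen (φ '' Set.Ioi 0)

variable (T) in
/-- A metric graph: a compact connected metric space in which every point has a star-shaped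
neighbourhood. -/
structure IsMetricGraph : Prop where
  compact : CompactSpace T
  connected : ConnectedSpace T
  edist_ne_top : ∀ p q : T, edist p q ≠ ∞
  star : ∀ p : T, HasStarNeighbourhood p

variable (T) in
/-- A tropical curve: a metric graph with finitely many unbounded edges `[0, ∞]` attached to it
(finitely many by compactness). Equivalently, it is compact, connected and Hausdorff, and
every point either has a star-shaped neighbourhood or is the infinite end of an unbounded edge. -/
structure IsTropicalCurve : Prop where
  compact : CompactSpace T
  connected : ConnectedSpace T
  hausdorff : T2Space T
  star_or_end : ∀ p : T, HasStarNeighbourhood p ∨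
    ∃ φ : ℝ≥0∞ → T, IsUnboundedEdge φ ∧ φ ∞ = p

variable (T) in
/-- A real structure: an isometry of `T` onto itself whose square is the identity. (Being a
homeomorphism matters only at the infinite ends, which the distance alone does not separate.) -/
structure RealStructure extends T ≃ₜ T where
  edist_map : ∀ p q : T, edist (toFun p) (toFun q) = edist p q
  involutive : Function.Involutive toFun

/-- The real locus `T(ℝ)`: the set of fixed points of the real structure. -/
def RealStructure.realLocus (ι : RealStructure T) : Set T :=
  {p | ι.toHomeomorph p = p}

/-- `C` is a connected component of the real locus. -/
def RealStructure.IsRealComponent (ι : RealStructure T) (C : Set T) : Prop :=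
  ∃ x ∈ ι.realLocus, C = connectedComponentIn ι.realLocus x

/-- Along the branch `γ`, the function `f` is affine near `γ 0`, with slope `m` in the direction
emanating from `γ 0`; its values there are finite. -/
def HasSlope (f : T → EReal) (γ : ℝ → T) (m : ℤ) : Prop :=
  ∃ y : ℝ, ∀ᶠ t in 𝓝[≥] (0 : ℝ), f (γ t) = ((y + m * t : ℝ) : EReal)

/-- Along the unbounded edge `φ`, the function `f` is affine near infinity, with slope `m` in the
direction towards infinity; its values are finite except possibly at the infinite end. -/
def HasSlopeTowardsInfinity (f : T → EReal) (φ : ℝ≥0∞ → T) (m : ℤ) : Prop :=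
  ∃ y : ℝ, ∀ᶠ t : ℝ in atTop, f (φ (ENNReal.ofReal t)) = ((y + m * t : ℝ) : EReal)

/-- Rational functions: continuous functions that are piecewise affine with integer slopes, with
finitely many pieces (the germ conditions at all points, ends included, give finitely many
pieces by compactness). The values `±∞` can occur only at infinite ends. -/
structure IsRationalFunction (f : T → EReal) : Prop where
  continuous : Continuous f
  slope : ∀ (p : T) (n : ℕ) (r : ℝ) (φ : Fin n → ℝ → T), IsStarChart p r φ →
    ∀ k, ∃ m : ℤ, HasSlope f (φ k) m
  slope_end : ∀ φ : ℝ≥0∞ → T, IsUnboundedEdge φ → ∃ m : ℤ, HasSlopeTowardsInfinity f φ m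

/-- `Δ(f)(p) = a`: the sum of the slopes of `f` in all directions emanating from `p` is `a`. -/
def HasSlopeSum (f : T → EReal) (p : T) (a : ℤ) : Prop :=
  (∃ (n : ℕ) (r : ℝ) (φ : Fin n → ℝ → T) (m : Fin n → ℤ),
    IsStarChart p r φ ∧ (∀ k, HasSlope f (φ k) (m k)) ∧ a = ∑ k, m k) ∨
  (∃ (φ : ℝ≥0∞ → T) (m : ℤ),
    IsUnboundedEdge φ ∧ φ ∞ = p ∧ HasSlopeTowardsInfinity f φ m ∧ a = -m)

/-- Divisors: finite `ℤ`-linear combinations of points. -/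
abbrev Divisor (T : Type*) := T →₀ ℤ

/-- Linear equivalence: `D₂ - D₁ = Δ(f)` for some rational function `f`. -/
def LinearlyEquivalent (D₁ D₂ : Divisor T) : Prop :=
  ∃ f : T → EReal, IsRationalFunction f ∧ ∀ p, HasSlopeSum f p (D₂ p - D₁ p)

/-- Real divisors: those which agree with their conjugate. -/
def RealStructure.IsRealDivisor (ι : RealStructure T) (D : Divisor T) : Prop :=
  ∀ p, D (ι.toHomeomorph p) = D p

open Classical in
/-- The degree of the restriction `D|_C`. -/
noncomputable def degreeOn {T : Type*} (D : Divisor T) (C : Set T) : ℤ :=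
  ∑ p ∈ D.support with p ∈ C, D p

end RealTropical

open RealTropical

/-! Let `g` be `f` with its values read as real numbers. Since `D₂ - D₁` is real, the slopes of `g -
g ∘ ι` at every point sum to zero: this function is harmonic. By a maximum principle it is constant
on the compact connected space, away from its values at the infinite ends, and the constant is `0`
because composing with `ι` changes the sign. So the slopes of `g` are invariant under `ι`
(`RealStructure.eventually_eq_comp`). At a point `p` of a real component `C`, a direction lies in
`C` exactly when `ι` preserves it. The other directions are exchanged in pairs of equal slope, so
modulo 2 the number `(D₂ - D₁)(p)` is the sum of the slopes along the directions inside `C`, the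
flux (`IsRealComponent.cast_flux_eq`). The total flux is zero, since a segment on which `g` is
affine contributes `m` at one end and `-m` at the other (`IsStarOrEnd.isBalanced`). No finite graph
model is chosen. A set is only required to be tame, i.e. to contain or avoid every direction.
Balance is proved on arcs by connectedness of the parameter interval, then globally by compactness.
Applied to a superlevel set, the same balance gives the maximum principle
(`IsStarAffine.germSlope_eq_zero`). -/

namespace RealTropical

/-! ### Topology against distance; star charts and unbounded edges. -/

section Metric

variable {T : Type*} [TopologicalSpace T] [WeakEMetricSpace T]

theorem exists_eball_subset {p : T} {U : Set T} (hU : U ∈ 𝓝 p) :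
    ∃ ε : ℝ, 0 < ε ∧ ∀ x, edist x p < ENNReal.ofReal ε → x ∈ U := by
  let m : PseudoEMetricSpace T := PseudoEMetricSpace.ofEDist edist
    WeakPseudoEMetricSpace.edist_self WeakPseudoEMetricSpace.edist_comm
    WeakPseudoEMetricSpace.edist_triangle
  obtain ⟨V, hVU, hV, hpV⟩ := mem_nhds_iff.1 hU
  obtain ⟨ε, hε, h⟩ := (@EMetric.isOpen_iff T m V).1
    (WeakPseudoEMetricSpace.topology_le V hV) p hpV
  obtain ⟨δ, hδ, hδε⟩ := ENNReal.lt_iff_exists_nnreal_btwn.1 hε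
  refine ⟨δ, by exact_mod_cast hδ, fun x hx => hVU (h ?_)⟩
  rw [ENNReal.ofReal_coe_nnreal] at hx
  exact hx.trans hδε

/-- The topology is the metric one only within finite distance, whence the hypothesis; it fails at
an infinite end. -/
theorem eball_mem_nhds {p : T} (h : {x | edist x p ≠ ∞} ∈ 𝓝 p) {ε : ℝ} (hε : 0 < ε) :
    {x | edist x p < ENNReal.ofReal ε} ∈ 𝓝 p := by
  obtain ⟨V, hV, hVe⟩ := WeakPseudoEMetricSpace.topology_eq_on_restrict p (ENNReal.ofReal ε)
  have key : ∀ x, edist x p ≠ ∞ → (x ∈ V ↔ edist x p < ENNReal.ofReal ε) := fun x hx => by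
    have := Set.ext_iff.1 hVe ⟨x, by simpa [Metric.mem_eball, lt_top_iff_ne_top] using hx⟩
    simpa [Metric.mem_eball] using this
  have hp : p ∈ V := (key p (by simp [WeakPseudoEMetricSpace.edist_self])).2
    (by simpa [WeakPseudoEMetricSpace.edist_self] using hε)
  filter_upwards [h, hV.mem_nhds hp] with x hx hxV
  exact (key x hx).1 hxV

theorem edist_eq_zero_iff {x y : T} : edist x y = 0 ↔ x = y :=
  ⟨WeakEMetricSpace.eq_of_edist_eq_zero, fun h => h ▸ WeakPseudoEMetricSpace.edist_self x⟩

theorem tendsto_nhds_of_edist {α : Type*} {l : Filter α} {u : α → T} {p : T}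
    (h : ∀ ε : ℝ, 0 < ε → ∀ᶠ a in l, edist (u a) p < ENNReal.ofReal ε) : Tendsto u l (𝓝 p) := by
  intro U hU
  obtain ⟨ε, hε, hs⟩ := exists_eball_subset hU
  exact mem_map.2 ((h ε hε).mono fun a ha => hs _ ha)

theorem t2Space_of_edist_ne_top (h : ∀ p q : T, edist p q ≠ ∞) : T2Space T := by
  refine ⟨fun p q hpq => ?_⟩
  have hpos : 0 < (edist p q).toReal :=
    ENNReal.toReal_pos (fun h0 => hpq (edist_eq_zero_iff.1 h0)) (h p q)
  have hn : ∀ x : T, {y | edist y x < ENNReal.ofReal ((edist p q).toReal / 2)} ∈ 𝓝 x := fun x =>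
    eball_mem_nhds (by simp [h]) (by positivity)
  obtain ⟨U, hU, hUo, hpU⟩ := mem_nhds_iff.1 (hn p)
  obtain ⟨V, hV, hVo, hqV⟩ := mem_nhds_iff.1 (hn q)
  refine ⟨U, V, hUo, hVo, hpU, hqV, Set.disjoint_left.2 fun x hxU hxV => ?_⟩
  have h1 : edist x p < _ := hU hxU
  have h2 : edist x q < _ := hV hxV
  have h3 := WeakPseudoEMetricSpace.edist_triangle p x q
  rw [WeakPseudoEMetricSpace.edist_comm p x] at h3
  refine absurd (h3.trans_lt (ENNReal.add_lt_add h1 h2)) ?_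
  rw [← ENNReal.ofReal_add (by positivity) (by positivity), add_halves,
    ENNReal.ofReal_toReal (h p q)]
  exact lt_irrefl _

theorem edist_ofReal {s t : ℝ} (hs : 0 ≤ s) (ht : 0 ≤ t) :
    edist (ENNReal.ofReal s) (ENNReal.ofReal t) = ENNReal.ofReal |s - t| := by
  have : edist (ENNReal.ofReal s) (ENNReal.ofReal t) = edist s.toNNReal t.toNNReal := rfl
  rw [this, edist_nndist, ← ENNReal.ofReal_coe_nnreal, coe_nndist, NNReal.dist_eq,
    Real.coe_toNNReal s hs, Real.coe_toNNReal t ht]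

theorem neBot_nhdsNE_top : (𝓝[≠] (∞ : ℝ≥0∞)).NeBot := by
  rw [← Set.Iio_top]
  exact nhdsLT_neBot_of_exists_lt ⟨0, ENNReal.zero_lt_top⟩

theorem edist_top_of_ne {t : ℝ≥0∞} (ht : t ≠ ∞) : edist t (∞ : ℝ≥0∞) = ∞ := by
  lift t to NNReal using ht
  rfl

namespace IsStarChart

variable {p : T} {n : ℕ} {r : ℝ} {φ : Fin n → ℝ → T}

theorem edist_center (h : IsStarChart p r φ) (k : Fin n) {t : ℝ} (ht : t ∈ Set.Ico 0 r) :
    edist (φ k t) p = ENNReal.ofReal t := by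
  have := h.edist_same k t ht 0 ⟨le_rfl, h.radius_pos⟩
  rwa [h.center, sub_zero, abs_of_nonneg ht.1] at this

theorem edist_ne_top_mem_nhds (h : IsStarChart p r φ) : {x | edist x p ≠ ∞} ∈ 𝓝 p := by
  filter_upwards [h.mem_nhds] with x hx
  obtain ⟨k, t, ht, rfl⟩ := Set.mem_iUnion.1 hx
  simp [h.edist_center k ht]

theorem eball_mem_nhds (h : IsStarChart p r φ) {ε : ℝ} (hε : 0 < ε) :
    {x | edist x p < ENNReal.ofReal ε} ∈ 𝓝 p :=
  RealTropical.eball_mem_nhds h.edist_ne_top_mem_nhds hε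

theorem Ioo_mem (h : IsStarChart p r φ) : Set.Ioo 0 r ∈ 𝓝[>] (0 : ℝ) :=
  Ioo_mem_nhdsGT h.radius_pos

theorem ne_center (h : IsStarChart p r φ) (k : Fin n) {t : ℝ} (ht : t ∈ Set.Ioo 0 r) :
    φ k t ≠ p := by
  rw [Ne, ← edist_eq_zero_iff, h.edist_center k ⟨ht.1.le, ht.2⟩]
  simpa using ht.1

theorem tendsto (h : IsStarChart p r φ) (k : Fin n) :
    Tendsto (φ k) (𝓝[>] 0) (𝓝[≠] p) := by
  refine tendsto_nhdsWithin_iff.2 ⟨tendsto_nhds_of_edist fun ε hε => ?_, ?_⟩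
  · filter_upwards [h.Ioo_mem, Ioo_mem_nhdsGT hε] with t ht hte
    rw [h.edist_center k ⟨ht.1.le, ht.2⟩]
    exact (ENNReal.ofReal_lt_ofReal_iff hε).2 hte.2
  · filter_upwards [h.Ioo_mem] with t ht
    exact h.ne_center k ht

theorem mem_nhdsNE_iff (h : IsStarChart p r φ) {S : Set T} :
    S ∈ 𝓝[≠] p ↔ ∀ k, S ∈ map (φ k) (𝓝[>] 0) := by
  refine ⟨fun hS k => h.tendsto k hS, fun hS => ?_⟩
  have hall : {t | ∀ k, φ k t ∈ S} ∈ 𝓝[>] (0 : ℝ) := eventually_all.2 hS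
  obtain ⟨ε, hε, hsub⟩ := mem_nhdsGT_iff_exists_Ioo_subset.1 hall
  rw [mem_nhdsWithin_iff_eventually]
  filter_upwards [h.mem_nhds, h.eball_mem_nhds (Set.mem_Ioi.1 hε)] with x hx hxε hxp
  obtain ⟨k, t, ht, rfl⟩ := Set.mem_iUnion.1 hx
  rw [h.edist_center k ht] at hxε
  refine hsub ⟨lt_of_le_of_ne ht.1 fun h0 => hxp ?_, (ENNReal.ofReal_lt_ofReal_iff hε).1 hxε⟩ k
  rw [← h0, h.center]
  rfl

theorem disjoint_branches (h : IsStarChart p r φ) {k l : Fin n} (hkl : k ≠ l) :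
    Disjoint (map (φ k) (𝓝[>] 0)) (map (φ l) (𝓝[>] 0)) := by
  refine Filter.disjoint_iff.2 ⟨_, image_mem_map h.Ioo_mem, _, image_mem_map h.Ioo_mem, ?_⟩
  rw [Set.disjoint_left]
  rintro _ ⟨s, hs, rfl⟩ ⟨t, ht, hst⟩
  have := h.edist_ne k l hkl s ⟨hs.1.le, hs.2⟩ t ⟨ht.1.le, ht.2⟩
  rw [edist_eq_zero_iff.2 hst.symm, eq_comm, ENNReal.ofReal_eq_zero] at this
  linarith [hs.1, ht.1]

theorem branch_injective (h : IsStarChart p r φ) :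
    Function.Injective fun k => map (φ k) (𝓝[>] (0 : ℝ)) := by
  intro k l hkl
  by_contra hne
  have := h.disjoint_branches hne
  simp only at hkl
  rw [hkl, disjoint_self] at this
  exact NeBot.ne inferInstance this

/-- A branch of one star chart coincides near the centre with a branch of any other one. -/
theorem exists_eventuallyEq (h : IsStarChart p r φ) {n' : ℕ} {r' : ℝ} {ψ : Fin n' → ℝ → T}
    (h' : IsStarChart p r' ψ) (k : Fin n) : ∃ l, φ k =ᶠ[𝓝[>] 0] ψ l := by
  have h1 : ∀ᶠ t in 𝓝[>] (0 : ℝ), φ k t ∈ ⋃ l, ψ l '' Set.Ico 0 r' :=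
    (h.tendsto k).mono_right nhdsWithin_le_nhds h'.mem_nhds
  have h2 : ∀ᶠ t in 𝓝[>] (0 : ℝ), t ∈ Set.Ioo 0 r' ∧ ∃ l, φ k t = ψ l t := by
    filter_upwards [h1, h.Ioo_mem] with t ht htr
    obtain ⟨l, s, hs, hst⟩ := Set.mem_iUnion.1 ht
    have := h.edist_center k ⟨htr.1.le, htr.2⟩
    rw [← hst, h'.edist_center l hs, ENNReal.ofReal_eq_ofReal_iff hs.1 htr.1.le] at this
    subst this
    exact ⟨⟨htr.1, hs.2⟩, l, hst.symm⟩
  obtain ⟨ε, hε, hsub⟩ := mem_nhdsGT_iff_exists_Ioo_subset.1 (inter_mem h2 h.Ioo_mem)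
  -- One point `φ k c` selects the branch `l`. Another point of branch `k` lying on a different
  -- branch would be at distance `t + c` from it instead of `|t - c|`.
  obtain ⟨c, hc⟩ := exists_between (Set.mem_Ioi.1 hε)
  obtain ⟨⟨hcr', l, hl⟩, hcr⟩ := hsub hc
  refine ⟨l, ?_⟩
  filter_upwards [Ioo_mem_nhdsGT (Set.mem_Ioi.1 hε)] with t ht
  obtain ⟨⟨htr', l', hl'⟩, htr⟩ := hsub ht
  by_cases hll : l' = l
  · rw [hl', hll]
  have e1 := h'.edist_ne l' l hll t ⟨htr'.1.le, htr'.2⟩ c ⟨hcr'.1.le, hcr'.2⟩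
  rw [← hl, ← hl', h.edist_same k t ⟨htr.1.le, htr.2⟩ c ⟨hcr.1.le, hcr.2⟩,
    ENNReal.ofReal_eq_ofReal_iff (abs_nonneg _) (by linarith [ht.1, hc.1])] at e1
  rcases abs_cases (t - c) with h3 | h3 <;> linarith [ht.1, hc.1]

end IsStarChart

namespace IsUnboundedEdge

variable {φ : ℝ≥0∞ → T}

theorem injective (h : IsUnboundedEdge φ) : Function.Injective φ := by
  intro s t hst
  have h1 := h.edist_eq s t
  rw [hst, WeakPseudoEMetricSpace.edist_self, eq_comm] at h1
  exact edist_eq_zero_iff.1 h1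

theorem map_nhds [T2Space T] (h : IsUnboundedEdge φ) {t : ℝ≥0∞} (ht : 0 < t) :
    map φ (𝓝 t) = 𝓝 (φ t) :=
  (h.continuous.isClosedEmbedding h.injective).isInducing.map_nhds_of_mem t <|
    mem_of_superset (h.isOpen.mem_nhds ⟨t, ht, rfl⟩) (Set.image_subset_range _ _)

theorem map_nhdsNE_top [T2Space T] (h : IsUnboundedEdge φ) :
    map φ (𝓝[≠] ∞) = 𝓝[≠] (φ ∞) := by
  refine le_antisymm ?_ fun S hS => ?_
  · exact (h.continuous.continuousWithinAt.tendsto_nhdsWithin fun x hx hx' =>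
      hx (h.injective hx') : Tendsto φ (𝓝[≠] ∞) (𝓝[≠] (φ ∞)))
  · rw [mem_nhdsWithin_iff_eventually, ← h.map_nhds ENNReal.zero_lt_top, eventually_map]
    filter_upwards [mem_nhdsWithin_iff_eventually.1 (mem_map.1 hS)] with t ht hne
    exact ht fun h' => hne (by rw [h']; rfl)

/-- Points arbitrarily close to the infinite end are at distance `∞` from it, whereas a star has
finite distances to its centre. So the two kinds of points exclude each other. -/
theorem not_hasStarNeighbourhood [T2Space T] (h : IsUnboundedEdge φ) :
    ¬ HasStarNeighbourhood (φ ∞) := by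
  rintro ⟨n, r, ψ, hψ⟩
  have h1 : {x | edist x (φ ∞) ≠ ∞} ∈ 𝓝[≠] (φ ∞) :=
    nhdsWithin_le_nhds hψ.edist_ne_top_mem_nhds
  rw [← h.map_nhdsNE_top, mem_map] at h1
  have : (𝓝[≠] (∞ : ℝ≥0∞)).NeBot := neBot_nhdsNE_top
  obtain ⟨t, ht, ht'⟩ := Filter.nonempty_of_mem (inter_mem h1 self_mem_nhdsWithin)
  exact ht (by rw [h.edist_eq, edist_top_of_ne ht'])

end IsUnboundedEdge

/-! ### Directions at a point, as filters. -/

section Directions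

/-- Every point is the centre of a star-shaped neighbourhood or the infinite end of an unbounded
edge. -/
def IsStarOrEnd (T : Type*) [TopologicalSpace T] [WeakEMetricSpace T] : Prop :=
  ∀ p : T, HasStarNeighbourhood p ∨ ∃ φ : ℝ≥0∞ → T, IsUnboundedEdge φ ∧ φ ∞ = p

open Classical in
/-- The directions emanating from a point, as filters of punctured one-sided neighbourhoods. -/
noncomputable def directions (p : T) : Finset (Filter T) :=
  if h : HasStarNeighbourhood p then
    Finset.univ.image fun k => map (h.choose_spec.choose_spec.choose k) (𝓝[>] 0)
  else {𝓝[≠] p}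

/-- Independence of the chosen chart: branches of two charts at `p` have the same germs. -/
theorem IsStarChart.mem_directions_iff {p : T} {n : ℕ} {r : ℝ} {φ : Fin n → ℝ → T}
    (h : IsStarChart p r φ) {d : Filter T} :
    d ∈ directions p ↔ ∃ k, map (φ k) (𝓝[>] 0) = d := by
  classical
  have hs : HasStarNeighbourhood p := ⟨n, r, φ, h⟩
  have h' := hs.choose_spec.choose_spec.choose_spec
  rw [directions, dif_pos hs]
  simp only [Finset.mem_image, Finset.mem_univ, true_and]
  constructor
  · rintro ⟨k, rfl⟩
    obtain ⟨l, hl⟩ := h'.exists_eventuallyEq h k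
    exact ⟨l, (map_congr hl).symm⟩
  · rintro ⟨k, rfl⟩
    obtain ⟨l, hl⟩ := h.exists_eventuallyEq h' k
    exact ⟨l, (map_congr hl).symm⟩

theorem IsStarChart.directions_eq {p : T} {n : ℕ} {r : ℝ} {φ : Fin n → ℝ → T}
    (h : IsStarChart p r φ) :
    directions p = Finset.univ.map ⟨fun k => map (φ k) (𝓝[>] 0), h.branch_injective⟩ := by
  ext d
  simp [h.mem_directions_iff]

theorem IsUnboundedEdge.directions_top [T2Space T] {φ : ℝ≥0∞ → T} (h : IsUnboundedEdge φ) :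
    directions (φ ∞) = {𝓝[≠] (φ ∞)} := by
  rw [directions, dif_neg h.not_hasStarNeighbourhood]

variable [T2Space T] {p : T} {d : Filter T}

theorem IsStarOrEnd.neBot (hT : IsStarOrEnd T) (hd : d ∈ directions p) : d.NeBot := by
  rcases hT p with ⟨n, r, φ, h⟩ | ⟨φ, h, rfl⟩
  · obtain ⟨k, rfl⟩ := h.mem_directions_iff.1 hd
    infer_instance
  · rw [h.directions_top, Finset.mem_singleton] at hd
    rw [hd, ← h.map_nhdsNE_top]
    have := neBot_nhdsNE_top
    infer_instance

theorem IsStarOrEnd.disjoint (hT : IsStarOrEnd T) {d' : Filter T} (hd : d ∈ directions p)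
    (hd' : d' ∈ directions p) (hne : d ≠ d') : Disjoint d d' := by
  rcases hT p with ⟨n, r, φ, h⟩ | ⟨φ, h, rfl⟩
  · obtain ⟨k, rfl⟩ := h.mem_directions_iff.1 hd
    obtain ⟨l, rfl⟩ := h.mem_directions_iff.1 hd'
    exact h.disjoint_branches fun hkl => hne (by rw [hkl])
  · rw [h.directions_top, Finset.mem_singleton] at hd hd'
    exact absurd (hd.trans hd'.symm) hne

theorem IsStarOrEnd.mem_nhdsNE_iff (hT : IsStarOrEnd T) {S : Set T} :
    S ∈ 𝓝[≠] p ↔ ∀ d ∈ directions p, S ∈ d := by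
  rcases hT p with ⟨n, r, φ, h⟩ | ⟨φ, h, rfl⟩
  · rw [h.mem_nhdsNE_iff]
    simp [h.mem_directions_iff]
  · simp [h.directions_top]

theorem IsStarOrEnd.le_nhdsNE (hT : IsStarOrEnd T) (hd : d ∈ directions p) : d ≤ 𝓝[≠] p :=
  fun _ hS => hT.mem_nhdsNE_iff.1 hS d hd

theorem IsStarOrEnd.le_nhds (hT : IsStarOrEnd T) (hd : d ∈ directions p) : d ≤ 𝓝 p :=
  (hT.le_nhdsNE hd).trans nhdsWithin_le_nhds

end Directions

end Metric

/-! ### Slopes along a direction. -/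

section Slopes

variable {T : Type*} [TopologicalSpace T] [WeakEMetricSpace T] {g : T → ℝ} {p : T} {d : Filter T}

/-- Along the direction `d`, the function `g` is affine with slope `m`, in the direction away from
the base point. -/
def HasGermSlope (g : T → ℝ) (d : Filter T) (m : ℤ) : Prop :=
  ∀ᶠ y in d, ∀ᶠ x in d, g y = g x + m * (edist x y).toReal

open Classical in
/-- The slope of `g` along the direction `d`. -/
noncomputable def germSlope (g : T → ℝ) (d : Filter T) : ℤ :=
  if h : ∃ m, HasGermSlope g d m then h.choose else 0

/-- All the slopes of `g` exist. -/
def IsPiecewiseAffine (g : T → ℝ) : Prop :=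
  ∀ p : T, ∀ d ∈ directions p, ∃ m, HasGermSlope g d m

/-- This makes slopes unique, as difference quotients. Both points tend to the base point without
reaching it, so the distance is finite even at an infinite end. -/
theorem IsStarOrEnd.eventually_toReal_edist_ne_zero [T2Space T] (hT : IsStarOrEnd T)
    (hd : d ∈ directions p) : ∀ᶠ y in d, ∀ᶠ x in d, (edist x y).toReal ≠ 0 := by
  rcases hT p with ⟨n, r, φ, h⟩ | ⟨φ, h, rfl⟩
  · obtain ⟨k, rfl⟩ := h.mem_directions_iff.1 hd
    simp only [eventually_map]
    filter_upwards [h.Ioo_mem] with t ht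
    filter_upwards [Ioo_mem_nhdsGT ht.1] with s hs
    rw [h.edist_same k s ⟨hs.1.le, hs.2.trans ht.2⟩ t ⟨ht.1.le, ht.2⟩,
      ENNReal.toReal_ofReal (abs_nonneg _)]
    exact abs_ne_zero.2 (sub_ne_zero.2 hs.2.ne)
  · rw [h.directions_top, Finset.mem_singleton] at hd
    rw [hd, ← h.map_nhdsNE_top]
    simp only [eventually_map]
    filter_upwards [self_mem_nhdsWithin] with t (ht : t ≠ ∞)
    have : Set.Ioi t ∈ 𝓝[≠] (∞ : ℝ≥0∞) :=
      nhdsWithin_le_nhds (isOpen_Ioi.mem_nhds (lt_top_iff_ne_top.2 ht))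
    filter_upwards [self_mem_nhdsWithin, this] with s (hs : s ≠ ∞) hst
    rw [h.edist_eq]
    lift t to NNReal using ht
    lift s to NNReal using hs
    have e : edist (s : ℝ≥0∞) (t : ℝ≥0∞) = edist s t := rfl
    have hne : s ≠ t := fun h' => by simp [h'] at hst
    rw [e, edist_nndist, ENNReal.coe_toReal, coe_nndist]
    exact dist_ne_zero.2 hne

theorem HasGermSlope.unique [T2Space T] (hT : IsStarOrEnd T) (hd : d ∈ directions p) {m m' : ℤ}
    (h : HasGermSlope g d m) (h' : HasGermSlope g d m') : m = m' := by
  have := hT.neBot hd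
  obtain ⟨y, h1, h2, h3⟩ := (h.and (h'.and (hT.eventually_toReal_edist_ne_zero hd))).exists
  obtain ⟨x, h1, h2, h3⟩ := (h1.and (h2.and h3)).exists
  have : (m : ℝ) * (edist x y).toReal = m' * (edist x y).toReal := by linarith
  exact_mod_cast mul_right_cancel₀ h3 this

theorem HasGermSlope.germSlope_eq [T2Space T] (hT : IsStarOrEnd T) (hd : d ∈ directions p) {m : ℤ}
    (h : HasGermSlope g d m) : germSlope g d = m := by
  have he : ∃ m, HasGermSlope g d m := ⟨m, h⟩
  rw [germSlope, dif_pos he]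
  exact he.choose_spec.unique hT hd h

theorem HasGermSlope.sub {g' : T → ℝ} {m m' : ℤ} (h : HasGermSlope g d m)
    (h' : HasGermSlope g' d m') : HasGermSlope (fun x => g x - g' x) d (m - m') := by
  filter_upwards [h, h'] with y hy hy'
  filter_upwards [hy, hy'] with x hx hx'
  rw [hx, hx']
  push_cast
  ring

theorem HasGermSlope.congr {g' : T → ℝ} {m : ℤ} (h : HasGermSlope g d m) (hg : g =ᶠ[d] g') :
    HasGermSlope g' d m := by
  filter_upwards [h, hg] with y hy hgy
  filter_upwards [hy, hg] with x hx hgx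
  rw [← hgy, ← hgx, hx]

/-- A function whose slope along `d` is zero is constant near the base point of `d`. -/
theorem HasGermSlope.eventually_eq_const [d.NeBot] (h : HasGermSlope g d 0) :
    ∃ c, ∀ᶠ x in d, g x = c := by
  obtain ⟨y, hy⟩ := h.exists
  refine ⟨g y, ?_⟩
  filter_upwards [hy] with x hx
  simpa using hx.symm

end Slopes

/-! ### Tame sets, flux and balance. -/

section Flux

variable {T : Type*} [TopologicalSpace T] [WeakEMetricSpace T] {g : T → ℝ}

/-- Every direction is either contained in `K` or contained in its complement. -/
def IsTame (K : Set T) : Prop := ∀ p : T, ∀ d ∈ directions p, K ∈ d ∨ Kᶜ ∈ d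

open Classical in
/-- The sum of the slopes of `g` at `p` in the directions contained in `K`. -/
noncomputable def flux (g : T → ℝ) (K : Set T) (p : T) : ℤ :=
  ∑ d ∈ directions p, if K ∈ d then germSlope g d else 0

/-- The slopes of `g` in the directions contained in `K` sum up to zero. -/
def IsBalanced (g : T → ℝ) (K : Set T) : Prop :=
  (Function.support (flux g K)).Finite ∧ ∑ᶠ p, flux g K p = 0

theorem IsTame.compl {K : Set T} (hK : IsTame K) : IsTame Kᶜ := fun p d hd => by
  rw [compl_compl]
  exact (hK p d hd).symm

theorem IsTame.union {K L : Set T} (hK : IsTame K) (hL : IsTame L) : IsTame (K ∪ L) := by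
  intro p d hd
  rcases hK p d hd with h | h
  · exact Or.inl (mem_of_superset h Set.subset_union_left)
  rcases hL p d hd with h' | h'
  · exact Or.inl (mem_of_superset h' Set.subset_union_right)
  · exact Or.inr (by rw [Set.compl_union]; exact inter_mem h h')

theorem IsTame.inter {K L : Set T} (hK : IsTame K) (hL : IsTame L) : IsTame (K ∩ L) := by
  simpa [Set.compl_union] using (hK.compl.union hL.compl).compl

theorem isTame_empty : IsTame (∅ : Set T) := fun _ _ _ => Or.inr (by simp)

theorem flux_eq_zero {K : Set T} {p : T} (h : ∀ d ∈ directions p, K ∉ d) : flux g K p = 0 :=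
  Finset.sum_eq_zero fun d hd => if_neg (h d hd)

theorem isBalanced_of_flux_eq_zero {K : Set T} (h : ∀ p, flux g K p = 0) : IsBalanced g K := by
  have : flux g K = 0 := funext h
  simp [IsBalanced, this]

variable [T2Space T]

theorem IsStarOrEnd.notMem_of_disjoint (hT : IsStarOrEnd T) {p : T} {d : Filter T}
    (hd : d ∈ directions p) {K L : Set T} (hKL : Disjoint K L) (hK : K ∈ d) : L ∉ d := fun hL => by
  have := hT.neBot hd
  obtain ⟨x, hx⟩ := Filter.nonempty_of_mem (inter_mem hK hL)
  exact Set.disjoint_left.1 hKL hx.1 hx.2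

theorem IsStarOrEnd.compl_mem_of_subset_singleton (hT : IsStarOrEnd T) {p x : T} {d : Filter T}
    (hd : d ∈ directions p) {K : Set T} (hK : K ⊆ {x}) : Kᶜ ∈ d := by
  refine mem_of_superset ?_ (Set.compl_subset_compl.2 hK)
  by_cases hpx : p = x
  · subst hpx
    exact hT.le_nhdsNE hd self_mem_nhdsWithin
  · exact hT.le_nhds hd (isOpen_compl_singleton.mem_nhds hpx)

theorem IsStarOrEnd.isTame_singleton (hT : IsStarOrEnd T) (x : T) : IsTame {x} :=
  fun _ _ hd => Or.inr (hT.compl_mem_of_subset_singleton hd Set.Subset.rfl)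

/-- Directions live in punctured neighbourhoods, so a single point carries no flux and may be added
or dropped freely. -/
theorem IsStarOrEnd.isBalanced_of_subset_singleton (hT : IsStarOrEnd T) {x : T} {K : Set T}
    (hK : K ⊆ {x}) : IsBalanced g K :=
  isBalanced_of_flux_eq_zero fun _ => flux_eq_zero fun _ hd h =>
    hT.notMem_of_disjoint hd disjoint_compl_right h (hT.compl_mem_of_subset_singleton hd hK)

theorem IsStarOrEnd.flux_union (hT : IsStarOrEnd T) {A B : Set T} (hA : IsTame A)
    (hAB : Disjoint A B) (p : T) : flux g (A ∪ B) p = flux g A p + flux g B p := by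
  classical
  rw [flux, flux, flux, ← Finset.sum_add_distrib]
  refine Finset.sum_congr rfl fun d hd => ?_
  rcases hA p d hd with h | h
  · rw [if_pos h, if_pos (mem_of_superset h Set.subset_union_left),
      if_neg (hT.notMem_of_disjoint hd hAB h), add_zero]
  · have h1 : A ∉ d := hT.notMem_of_disjoint hd disjoint_compl_left h
    have h2 : A ∪ B ∈ d ↔ B ∈ d :=
      ⟨fun h' => mem_of_superset (inter_mem h h') fun x hx => hx.2.resolve_left hx.1,
        fun h' => mem_of_superset h' Set.subset_union_right⟩
    simp only [h1, h2, if_false, zero_add]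

/-- Flux is additive on disjoint sets, and only `A` has to be tame: a balanced tame piece can be
glued to, or cut off from, an arbitrary set. -/
theorem IsStarOrEnd.isBalanced_union_iff (hT : IsStarOrEnd T) {A B : Set T} (hA : IsTame A)
    (hAB : Disjoint A B) (hAb : IsBalanced g A) : IsBalanced g (A ∪ B) ↔ IsBalanced g B := by
  have e : flux g (A ∪ B) = fun p => flux g A p + flux g B p := funext (hT.flux_union hA hAB)
  have key : (Function.support (flux g (A ∪ B))).Finite ↔ (Function.support (flux g B)).Finite := by
    constructor
    · intro h
      refine (h.union hAb.1).subset fun p hp => ?_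
      by_contra hn
      simp only [Set.mem_union, Function.mem_support, not_or, not_not, e] at hn hp
      exact hp (by linarith)
    · intro h
      refine (hAb.1.union h).subset fun p hp => ?_
      by_contra hn
      simp only [Set.mem_union, Function.mem_support, not_or, not_not, e] at hn hp
      exact hp (by linarith)
  unfold IsBalanced
  rw [key]
  refine and_congr_right fun h => ?_
  rw [e, finsum_add_distrib hAb.1 h, hAb.2, zero_add]

end Flux

/-! ### Balance along an arc. -/

section Arcs

set_option linter.unusedSectionVars false

variable {T : Type*} [TopologicalSpace T] [WeakEMetricSpace T] {g : T → ℝ}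
  {α : Type*} [ConditionallyCompleteLinearOrder α] [TopologicalSpace α] [OrderTopology α]
  [DenselyOrdered α] {γ : α → T} {a b : α}

/-- `γ` parametrizes an arc whose interior points are bivalent, in such a way that the distance is
additive along the interior of the arc. -/
structure IsArc (γ : α → T) (a b : α) : Prop where
  continuousOn : ContinuousOn γ (Set.Icc a b)
  injOn : Set.InjOn γ (Set.Icc a b)
  right : ∀ t ∈ Set.Ico a b, map γ (𝓝[>] t) ∈ directions (γ t)
  left : ∀ t ∈ Set.Ioc a b, map γ (𝓝[<] t) ∈ directions (γ t)
  eq_or : ∀ t ∈ Set.Ioo a b, ∀ d ∈ directions (γ t), d = map γ (𝓝[>] t) ∨ d = map γ (𝓝[<] t)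
  edist_add : ∀ s t u, a < s → s < t → t < u → u < b →
    (edist (γ s) (γ u)).toReal = (edist (γ s) (γ t)).toReal + (edist (γ t) (γ u)).toReal

namespace IsArc

theorem mono (h : IsArc γ a b) {s t : α} (hs : a ≤ s) (ht : t ≤ b) : IsArc γ s t where
  continuousOn := h.continuousOn.mono (Set.Icc_subset_Icc hs ht)
  injOn := h.injOn.mono (Set.Icc_subset_Icc hs ht)
  right u hu := h.right u ⟨hs.trans hu.1, hu.2.trans_le ht⟩
  left u hu := h.left u ⟨hs.trans_lt hu.1, hu.2.trans ht⟩
  eq_or u hu := h.eq_or u ⟨hs.trans_lt hu.1, hu.2.trans_le ht⟩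
  edist_add u v w h1 h2 h3 h4 := h.edist_add u v w (hs.trans_lt h1) h2 h3 (h4.trans_le ht)

/-- Reversal turns statements about the origin of an arc into statements about its end. An abstract
parameter order allows this, and covers both `ℝ` and `[0, ∞]`. -/
theorem dual (h : IsArc γ a b) :
    IsArc (γ ∘ OrderDual.ofDual) (OrderDual.toDual b) (OrderDual.toDual a) where
  continuousOn := by
    rw [Set.Icc_toDual]
    exact h.continuousOn
  injOn := by
    rw [Set.Icc_toDual]
    exact h.injOn
  right u hu := h.left u ⟨hu.2, hu.1⟩
  left u hu := h.right u ⟨hu.2, hu.1⟩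
  eq_or u hu d hd := (h.eq_or u ⟨hu.2, hu.1⟩ d hd).symm
  edist_add u v w h1 h2 h3 h4 := by
    have := h.edist_add w v u h4 h3 h2 h1
    rw [add_comm]
    simp only [WeakPseudoEMetricSpace.edist_comm] at this ⊢
    exact this

theorem image_dual (s t : α) :
    (γ ∘ OrderDual.ofDual) '' Set.Ioo (OrderDual.toDual t) (OrderDual.toDual s) =
      γ '' Set.Ioo s t := by
  rw [Set.Ioo_toDual, Set.image_comp, ← OrderDual.toDual_symm_eq, Equiv.image_symm_eq_preimage]
  rfl

variable [T2Space T]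

theorem compl_mem_nhds (h : IsArc γ a b) {p : T} (hp : p ∉ γ '' Set.Icc a b) :
    (γ '' Set.Icc a b)ᶜ ∈ 𝓝 p :=
  (isCompact_Icc.image_of_continuousOn h.continuousOn).isClosed.isOpen_compl.mem_nhds hp

theorem mem_right {t : α} (ht : t < b) : γ '' Set.Ioo t b ∈ map γ (𝓝[>] t) :=
  image_mem_map (Ioo_mem_nhdsGT ht)

/-- The only direction at the origin of an arc which does not avoid it is the direction of the
arc. -/
theorem eq_right_or_compl_mem (hT : IsStarOrEnd T) (h : IsArc γ a b) (hab : a < b) {d : Filter T}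
    (hd : d ∈ directions (γ a)) : d = map γ (𝓝[>] a) ∨ (γ '' Set.Ioo a b)ᶜ ∈ d := by
  refine or_iff_not_imp_left.2 fun hne => ?_
  -- Near `γ a` the direction `d` misses the initial part of the arc because distinct directions are
  -- disjoint, and the rest because it is compact and, by injectivity, does not contain `γ a`.
  obtain ⟨V, hV, W, hW, hVW⟩ := Filter.disjoint_iff.1
    (hT.disjoint hd (h.right a ⟨le_rfl, hab⟩) hne)
  obtain ⟨u, hu, hsub⟩ := (mem_nhdsGT_iff_exists_Ioo_subset' hab).1 (mem_map.1 hW)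
  have hu : a < u := hu
  have hclosed : (γ '' Set.Icc u b)ᶜ ∈ 𝓝 (γ a) := (h.mono hu.le le_rfl).compl_mem_nhds (by
    rintro ⟨t, ht, hta⟩
    exact (hu.trans_le ht.1).ne' (h.injOn ⟨hu.le.trans ht.1, ht.2⟩ ⟨le_rfl, hab.le⟩ hta))
  filter_upwards [hV, hT.le_nhds hd hclosed] with x hxV hx
  rintro ⟨t, ht, rfl⟩
  rcases lt_or_ge t u with htu | htu
  · exact Set.disjoint_left.1 hVW hxV (hsub ⟨ht.1, htu⟩)
  · exact hx ⟨t, ⟨htu, ht.2.le⟩, rfl⟩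

theorem eq_left_or_compl_mem (hT : IsStarOrEnd T) (h : IsArc γ a b) (hab : a < b) {d : Filter T}
    (hd : d ∈ directions (γ b)) : d = map γ (𝓝[<] b) ∨ (γ '' Set.Ioo a b)ᶜ ∈ d := by
  have := h.dual.eq_right_or_compl_mem hT hab hd
  rwa [image_dual] at this

theorem right_ne_left (h : IsArc γ a b) {t : α} (ht : t ∈ Set.Ioo a b) :
    map γ (𝓝[>] t) ≠ map γ (𝓝[<] t) := by
  intro he
  have h1 : γ '' Set.Ioo t b ∈ map γ (𝓝[>] t) := image_mem_map (Ioo_mem_nhdsGT ht.2)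
  have h2 : γ '' Set.Ioo a t ∈ map γ (𝓝[>] t) := he ▸ image_mem_map (Ioo_mem_nhdsLT ht.1)
  have : (𝓝[>] t).NeBot := nhdsGT_neBot_of_exists_gt ⟨b, ht.2⟩
  obtain ⟨_, ⟨u, hu, rfl⟩, v, hv, huv⟩ := Filter.nonempty_of_mem (inter_mem h1 h2)
  exact (hv.2.trans hu.1).ne (h.injOn ⟨hv.1.le, (hv.2.trans ht.2).le⟩
    ⟨(ht.1.trans hu.1).le, hu.2.le⟩ huv)

theorem directions_eq [DecidableEq (Filter T)] (h : IsArc γ a b) {t : α} (ht : t ∈ Set.Ioo a b) :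
    directions (γ t) = {map γ (𝓝[>] t), map γ (𝓝[<] t)} := by
  ext d
  simp only [Finset.mem_insert, Finset.mem_singleton]
  refine ⟨h.eq_or t ht d, ?_⟩
  rintro (rfl | rfl)
  · exact h.right t ⟨ht.1.le, ht.2⟩
  · exact h.left t ⟨ht.1, ht.2.le⟩

theorem Ioo_mem (h : IsArc γ a b) {t : α} (ht : t ∈ Set.Ioo a b) {d : Filter T}
    (hd : d ∈ directions (γ t)) : γ '' Set.Ioo a b ∈ d := by
  rcases h.eq_or t ht d hd with rfl | rfl
  · exact image_mem_map (mem_of_superset (Ioo_mem_nhdsGT ht.2) (Set.Ioo_subset_Ioo_left ht.1.le))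
  · exact image_mem_map (mem_of_superset (Ioo_mem_nhdsLT ht.1) (Set.Ioo_subset_Ioo_right ht.2.le))

theorem isTame (hT : IsStarOrEnd T) (h : IsArc γ a b) : IsTame (γ '' Set.Ioo a b) := by
  intro p d hd
  rcases le_or_gt b a with hab | hab
  · simp [Set.Ioo_eq_empty hab.not_gt]
  by_cases hp : p ∈ γ '' Set.Icc a b
  · obtain ⟨t, ht, rfl⟩ := hp
    rcases eq_or_lt_of_le ht.1 with rfl | hat
    · refine (h.eq_right_or_compl_mem hT hab hd).imp_left ?_
      rintro rfl
      exact mem_right hab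
    rcases eq_or_lt_of_le ht.2 with rfl | htb
    · refine (h.eq_left_or_compl_mem hT hab hd).imp_left ?_
      rintro rfl
      exact image_mem_map (Ioo_mem_nhdsLT hab)
    · exact Or.inl (h.Ioo_mem ⟨hat, htb⟩ hd)
  · exact Or.inr (mem_of_superset (hT.le_nhds hd (h.compl_mem_nhds hp))
      (Set.compl_subset_compl.2 (Set.image_mono Set.Ioo_subset_Icc_self)))

/-- The interior of an arc on which `g` is affine is balanced. -/
theorem isBalanced_of_slopes (hT : IsStarOrEnd T) (h : IsArc γ a b) (hab : a < b) {m : ℤ}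
    (hr : ∀ t ∈ Set.Ico a b, germSlope g (map γ (𝓝[>] t)) = m)
    (hl : ∀ t ∈ Set.Ioc a b, germSlope g (map γ (𝓝[<] t)) = -m) :
    IsBalanced g (γ '' Set.Ioo a b) := by
  classical
  have ha : flux g (γ '' Set.Ioo a b) (γ a) = m := by
    rw [flux, Finset.sum_eq_single_of_mem _ (h.right a ⟨le_rfl, hab⟩), if_pos (mem_right hab),
      hr a ⟨le_rfl, hab⟩]
    intro d hd hne
    exact if_neg (hT.notMem_of_disjoint hd disjoint_compl_left
      ((h.eq_right_or_compl_mem hT hab hd).resolve_left hne))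
  have hb : flux g (γ '' Set.Ioo a b) (γ b) = -m := by
    rw [flux, Finset.sum_eq_single_of_mem _ (h.left b ⟨hab, le_rfl⟩),
      if_pos (image_mem_map (Ioo_mem_nhdsLT hab)), hl b ⟨hab, le_rfl⟩]
    intro d hd hne
    exact if_neg (hT.notMem_of_disjoint hd disjoint_compl_left
      ((h.eq_left_or_compl_mem hT hab hd).resolve_left hne))
  have hsupp : Function.support (flux g (γ '' Set.Ioo a b)) ⊆ (({γ a, γ b} : Finset T) : Set T) := by
    intro p hp
    simp only [Finset.coe_insert, Finset.coe_singleton, Set.mem_insert_iff, Set.mem_singleton_iff]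
    by_contra! hn
    refine hp ?_
    by_cases hpI : p ∈ γ '' Set.Icc a b
    · obtain ⟨t, ht, rfl⟩ := hpI
      have ht' : t ∈ Set.Ioo a b := ⟨lt_of_le_of_ne ht.1 fun h' => hn.1 (by rw [h']),
        lt_of_le_of_ne ht.2 fun h' => hn.2 (by rw [h'])⟩
      rw [flux, Finset.sum_congr rfl fun d hd => if_pos (h.Ioo_mem ht' hd), h.directions_eq ht',
        Finset.sum_pair (h.right_ne_left ht'), hr t ⟨ht.1, ht'.2⟩, hl t ⟨ht'.1, ht.2⟩,
        add_neg_cancel]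
    · exact flux_eq_zero fun d hd => hT.notMem_of_disjoint hd disjoint_compl_left
        (mem_of_superset (hT.le_nhds hd (h.compl_mem_nhds hpI))
          (Set.compl_subset_compl.2 (Set.image_mono Set.Ioo_subset_Icc_self)))
  refine ⟨(Finset.finite_toSet _).subset hsupp, ?_⟩
  rw [finsum_eq_sum_of_support_subset _ hsupp, Finset.sum_pair, ha, hb, add_neg_cancel]
  exact fun h' => hab.ne (h.injOn ⟨le_rfl, hab.le⟩ ⟨hab.le, le_rfl⟩ h')

variable {K : Set T}

theorem eventually_right_isBalanced (hT : IsStarOrEnd T) (hg : IsPiecewiseAffine g)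
    (hK : IsTame K) (h : IsArc γ a b) (hab : a < b) :
    ∀ᶠ s in 𝓝[>] a, IsBalanced g (K ∩ γ '' Set.Ioo a s) := by
  have hd := h.right a ⟨le_rfl, hab⟩
  obtain ⟨m, hm⟩ := hg _ _ hd
  obtain ⟨u, ⟨hau, hub⟩, hsub⟩ := (mem_nhdsGT_iff_exists_mem_Ioc_Ioo_subset hab).1
    (mem_map.1 (eventually_map.1 hm))
  -- Both points are compared with a third one close to `a`; additivity of the distance then gives
  -- the slope between them.
  have hslope : ∀ s ∈ Set.Ioo a u, ∀ t ∈ Set.Ioo a u, s < t →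
      g (γ t) = g (γ s) + m * (edist (γ s) (γ t)).toReal := by
    intro s hs t ht hst
    have : (𝓝[>] a).NeBot := nhdsGT_neBot_of_exists_gt ⟨b, hab⟩
    have h1 : ∀ᶠ x in 𝓝[>] a, g (γ s) = g (γ x) + m * (edist (γ x) (γ s)).toReal := hsub hs
    have h2 : ∀ᶠ x in 𝓝[>] a, g (γ t) = g (γ x) + m * (edist (γ x) (γ t)).toReal := hsub ht
    obtain ⟨x, h1, h2, hx⟩ := (h1.and (h2.and (Ioo_mem_nhdsGT hs.1))).exists
    rw [h.edist_add x s t hx.1 hx.2 hst (ht.2.trans_le hub)] at h2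
    linarith
  have hr : ∀ t ∈ Set.Ico a u, germSlope g (map γ (𝓝[>] t)) = m := by
    intro t ht
    refine HasGermSlope.germSlope_eq hT (h.right t ⟨ht.1, ht.2.trans_le hub⟩) ?_
    rcases eq_or_lt_of_le ht.1 with rfl | hat
    · exact hm
    simp only [HasGermSlope, eventually_map]
    filter_upwards [Ioo_mem_nhdsGT ht.2] with y hy
    filter_upwards [Ioo_mem_nhdsGT hy.1] with x hx
    exact hslope x ⟨hat.trans hx.1, hx.2.trans hy.2⟩ y ⟨hat.trans hy.1, hy.2⟩ hx.2
  have hl : ∀ t ∈ Set.Ioo a u, germSlope g (map γ (𝓝[<] t)) = -m := by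
    intro t ht
    refine HasGermSlope.germSlope_eq hT (h.left t ⟨ht.1, ht.2.le.trans hub⟩) ?_
    simp only [HasGermSlope, eventually_map]
    filter_upwards [Ioo_mem_nhdsLT ht.1] with y hy
    filter_upwards [Ioo_mem_nhdsLT hy.2] with x hx
    have := hslope y ⟨hy.1, hy.2.trans ht.2⟩ x ⟨hy.1.trans hx.1, hx.2.trans ht.2⟩ hx.1
    rw [WeakPseudoEMetricSpace.edist_comm, this]
    push_cast
    ring
  have hbal : ∀ s ∈ Set.Ioo a u, IsBalanced g (γ '' Set.Ioo a s) := fun s hs =>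
    (h.mono le_rfl (hs.2.le.trans hub)).isBalanced_of_slopes hT hs.1
      (fun t ht => hr t ⟨ht.1, ht.2.trans hs.2⟩) (fun t ht => hl t ⟨ht.1, ht.2.trans_lt hs.2⟩)
  -- By tameness, `K` contains or avoids a short initial piece of the arc.
  rcases hK _ _ hd with hKd | hKd <;>
    obtain ⟨v, ⟨hav, hvb⟩, hv⟩ :=
      (mem_nhdsGT_iff_exists_mem_Ioc_Ioo_subset hab).1 (mem_map.1 hKd)
  · filter_upwards [Ioo_mem_nhdsGT hau, Ioo_mem_nhdsGT hav] with s hsu hsv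
    rw [Set.inter_eq_right.2]
    · exact hbal s hsu
    · rintro _ ⟨t, ht, rfl⟩
      exact hv ⟨ht.1, ht.2.trans hsv.2⟩
  · filter_upwards [Ioo_mem_nhdsGT hav] with s hsv
    refine hT.isBalanced_of_subset_singleton (x := γ a) ?_
    rintro _ ⟨hxK, t, ht, rfl⟩
    exact absurd hxK (hv ⟨ht.1, ht.2.trans hsv.2⟩)

theorem eventually_left_isBalanced (hT : IsStarOrEnd T) (hg : IsPiecewiseAffine g)
    (hK : IsTame K) (h : IsArc γ a b) (hab : a < b) :
    ∀ᶠ s in 𝓝[<] b, IsBalanced g (K ∩ γ '' Set.Ioo s b) := by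
  have := h.dual.eventually_right_isBalanced hT hg hK hab
  refine Eventually.mono (f := 𝓝[<] b) this fun s hs => ?_
  rwa [← image_dual]

theorem isBalanced_iff_of_isBalanced (hT : IsStarOrEnd T) (hK : IsTame K) (h : IsArc γ a b)
    {s t : α} (has : a ≤ s) (hst : s < t) (htb : t ≤ b)
    (hbal : IsBalanced g (K ∩ γ '' Set.Ioo s t)) :
    IsBalanced g (K ∩ γ '' Set.Ioo a s) ↔ IsBalanced g (K ∩ γ '' Set.Ioo a t) := by
  rcases eq_or_lt_of_le has with rfl | has
  · refine iff_of_true (hT.isBalanced_of_subset_singleton (x := γ a) (by simp)) hbal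
  have e : K ∩ γ '' Set.Ioo a t =
      (K ∩ {γ s}) ∪ ((K ∩ γ '' Set.Ioo s t) ∪ (K ∩ γ '' Set.Ioo a s)) := by
    rw [← Set.inter_union_distrib_left, ← Set.inter_union_distrib_left, ← Set.image_union,
      ← Set.image_singleton, ← Set.image_union]
    congr 2
    ext x
    simp only [Set.mem_Ioo, Set.mem_union, Set.mem_singleton_iff]
    constructor
    · rintro ⟨h1, h2⟩
      rcases lt_trichotomy x s with h3 | h3 | h3 <;> simp [*]
    · rintro (rfl | ⟨h1, h2⟩ | ⟨h1, h2⟩)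
      · exact ⟨has, hst⟩
      · exact ⟨has.trans h1, h2⟩
      · exact ⟨h1, h2.trans hst⟩
  have hdisj : ∀ A B : Set α, A ⊆ Set.Icc a b → B ⊆ Set.Icc a b → Disjoint A B →
      Disjoint (K ∩ γ '' A) (K ∩ γ '' B) := by
    intro A B hA hB hAB
    rw [Set.disjoint_left]
    rintro _ ⟨-, x, hx, rfl⟩ ⟨-, y, hy, hxy⟩
    exact Set.disjoint_left.1 hAB hx (h.injOn (hB hy) (hA hx) hxy ▸ hy)
  have hIs : {s} ⊆ Set.Icc a b := Set.singleton_subset_iff.2 ⟨has.le, hst.le.trans htb⟩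
  have hIst : Set.Ioo s t ⊆ Set.Icc a b := fun x hx => ⟨(has.trans hx.1).le, hx.2.le.trans htb⟩
  have hIas : Set.Ioo a s ⊆ Set.Icc a b := fun x hx => ⟨hx.1.le, (hx.2.trans hst).le.trans htb⟩
  rw [e, hT.isBalanced_union_iff (hK.inter (hT.isTame_singleton _)) _
    (hT.isBalanced_of_subset_singleton Set.inter_subset_right),
    hT.isBalanced_union_iff (hK.inter ((h.mono has.le htb).isTame hT)) _ hbal]
  · refine hdisj _ _ hIst hIas (Set.disjoint_left.2 fun x hx hx' => ?_)
    exact absurd (hx.1.trans hx'.2) (lt_irrefl _)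
  · rw [← Set.inter_union_distrib_left, ← Set.image_union, ← Set.image_singleton]
    refine hdisj _ _ hIs (Set.union_subset hIst hIas) (Set.disjoint_left.2 ?_)
    rintro x rfl (hx | hx)
    · exact lt_irrefl _ hx.1
    · exact lt_irrefl _ hx.2

/-- The intersection of a tame set with the interior of an arc is balanced. -/
theorem isBalanced_inter (hT : IsStarOrEnd T) (hg : IsPiecewiseAffine g) (hK : IsTame K)
    (h : IsArc γ a b) (hab : a < b) : IsBalanced g (K ∩ γ '' Set.Ioo a b) := by
  -- The truth of "balanced up to `s`" is locally constant in `s`, by balance of short pieces on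
  -- both sides of each parameter, and it holds at `s = a`, where the set is empty.
  refine (isPreconnected_Icc.induction₂
    (fun s t => IsBalanced g (K ∩ γ '' Set.Ioo a s) ↔ IsBalanced g (K ∩ γ '' Set.Ioo a t))
    ?_ (fun _ _ _ _ _ _ => Iff.trans) (fun _ _ _ _ => Iff.symm)
    (Set.left_mem_Icc.2 hab.le) (Set.right_mem_Icc.2 hab.le)).1
    (hT.isBalanced_of_subset_singleton (x := γ a) (by simp))
  intro s hs
  have h1 : s < b → ∀ᶠ t in 𝓝 s, s < t → IsBalanced g (K ∩ γ '' Set.Ioo s t) := fun hsb =>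
    eventually_nhdsWithin_iff.1 ((h.mono hs.1 le_rfl).eventually_right_isBalanced hT hg hK hsb)
  have h2 : a < s → ∀ᶠ t in 𝓝 s, t < s → IsBalanced g (K ∩ γ '' Set.Ioo t s) := fun has =>
    eventually_nhdsWithin_iff.1 ((h.mono le_rfl hs.2).eventually_left_isBalanced hT hg hK has)
  filter_upwards [nhdsWithin_le_nhds (eventually_imp_distrib_left.2 h1),
    nhdsWithin_le_nhds (eventually_imp_distrib_left.2 h2), self_mem_nhdsWithin] with t ht1 ht2 ht
  rcases lt_trichotomy s t with hst | rfl | hst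
  · exact h.isBalanced_iff_of_isBalanced hT hK hs.1 hst ht.2 (ht1 (hst.trans_le ht.2) hst)
  · rfl
  · exact (h.isBalanced_iff_of_isBalanced hT hK ht.1 hst hs.2 (ht2 (ht.1.trans_lt hst) hst)).symm

end IsArc

end Arcs

/-! ### Branches and unbounded edges as arcs; global balance. -/

section Charts

variable {T : Type*} [TopologicalSpace T] [WeakEMetricSpace T]

theorem map_add_nhdsGT_zero (t : ℝ) : map (fun s => t + s) (𝓝[>] 0) = 𝓝[>] t := by
  simp

theorem map_sub_nhdsGT_zero (t : ℝ) : map (fun s => t - s) (𝓝[>] 0) = 𝓝[<] t := by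
  simp

/-- The midpoint of an open geodesic is bivalent. -/
theorem isStarChart_of_geodesic {γ : ℝ → T} {t r : ℝ} (hr : 0 < r)
    (hγ : ∀ s ∈ Set.Ioo (t - r) (t + r), ∀ u ∈ Set.Ioo (t - r) (t + r),
      edist (γ s) (γ u) = ENNReal.ofReal |s - u|)
    (hn : γ '' Set.Ioo (t - r) (t + r) ∈ 𝓝 (γ t)) :
    IsStarChart (γ t) r (![fun s => γ (t + s), fun s => γ (t - s)] : Fin 2 → ℝ → T) where
  valence_pos := two_pos
  radius_pos := hr
  center k := by fin_cases k <;> simp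
  edist_same k s hs u hu := by
    fin_cases k
    · simpa using hγ (t + s) ⟨by linarith [hs.1], by linarith [hs.2]⟩ (t + u)
        ⟨by linarith [hu.1], by linarith [hu.2]⟩
    · have := hγ (t - s) ⟨by linarith [hs.2], by linarith [hs.1]⟩ (t - u)
        ⟨by linarith [hu.2], by linarith [hu.1]⟩
      rw [sub_sub_sub_cancel_left, abs_sub_comm] at this
      exact this
  edist_ne k l hkl s hs u hu := by
    have e : ∀ s ∈ Set.Ico 0 r, ∀ u ∈ Set.Ico 0 r,
        edist (γ (t + s)) (γ (t - u)) = ENNReal.ofReal (s + u) := fun s hs u hu => by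
      rw [hγ (t + s) ⟨by linarith [hs.1], by linarith [hs.2]⟩ (t - u)
        ⟨by linarith [hu.2], by linarith [hu.1]⟩, show t + s - (t - u) = s + u by ring,
        abs_of_nonneg (add_nonneg hs.1 hu.1)]
    fin_cases k <;> fin_cases l
    · exact absurd rfl hkl
    · exact e s hs u hu
    · rw [add_comm, WeakPseudoEMetricSpace.edist_comm]
      exact e u hu s hs
    · exact absurd rfl hkl
  mem_nhds := by
    refine mem_of_superset hn ?_
    rintro _ ⟨s, hs, rfl⟩
    rcases le_total t s with h | h
    · exact Set.mem_iUnion.2 ⟨0, s - t, ⟨by linarith, by linarith [hs.2]⟩, by simp⟩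
    · exact Set.mem_iUnion.2 ⟨1, t - s, ⟨by linarith, by linarith [hs.1]⟩, by simp⟩

theorem mem_directions_of_geodesic {γ : ℝ → T} {t r : ℝ} (hr : 0 < r)
    (hγ : ∀ s ∈ Set.Ioo (t - r) (t + r), ∀ u ∈ Set.Ioo (t - r) (t + r),
      edist (γ s) (γ u) = ENNReal.ofReal |s - u|)
    (hn : γ '' Set.Ioo (t - r) (t + r) ∈ 𝓝 (γ t)) {d : Filter T} :
    d ∈ directions (γ t) ↔ d = map γ (𝓝[>] t) ∨ d = map γ (𝓝[<] t) := by
  have e1 : map γ (𝓝[>] t) = map (fun s => γ (t + s)) (𝓝[>] 0) := by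
    rw [← map_add_nhdsGT_zero t, map_map]
    rfl
  have e2 : map γ (𝓝[<] t) = map (fun s => γ (t - s)) (𝓝[>] 0) := by
    rw [← map_sub_nhdsGT_zero t, map_map]
    rfl
  rw [(isStarChart_of_geodesic hr hγ hn).mem_directions_iff, Fin.exists_fin_two, e1, e2]
  exact Iff.or eq_comm eq_comm

theorem continuousOn_of_edist {γ : ℝ → T} {S : Set ℝ}
    (h : ∀ s ∈ S, ∀ t ∈ S, edist (γ s) (γ t) = ENNReal.ofReal |s - t|) : ContinuousOn γ S := by
  intro t ht
  refine tendsto_nhds_of_edist fun ε hε => ?_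
  filter_upwards [self_mem_nhdsWithin, nhdsWithin_le_nhds (Metric.ball_mem_nhds t hε)] with s hs hst
  rw [h s hs t ht]
  exact (ENNReal.ofReal_lt_ofReal_iff hε).2 hst

theorem injOn_of_edist {γ : ℝ → T} {S : Set ℝ}
    (h : ∀ s ∈ S, ∀ t ∈ S, edist (γ s) (γ t) = ENNReal.ofReal |s - t|) : Set.InjOn γ S := by
  intro s hs t ht hst
  have := h s hs t ht
  rw [edist_eq_zero_iff.2 hst, eq_comm, ENNReal.ofReal_eq_zero] at this
  exact sub_eq_zero.1 (abs_eq_zero.1 (le_antisymm this (abs_nonneg _)))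

/-- A short initial segment of a branch of a star chart is an arc. -/
theorem IsStarChart.exists_isArc {p : T} {n : ℕ} {r : ℝ} {φ : Fin n → ℝ → T}
    (h : IsStarChart p r φ) : ∃ b, 0 < b ∧ b < r ∧ ∀ k, IsArc (φ k) 0 b := by
  -- The star is a neighbourhood of its centre only, so `b` is taken small enough for the points at
  -- distance at most `b` to be interior to it.
  obtain ⟨ε, hε, hsub⟩ := exists_eball_subset (interior_mem_nhds.2 h.mem_nhds)
  obtain ⟨b, hb, hbm⟩ := exists_between (lt_min hε h.radius_pos)
  obtain ⟨hbε, hbr⟩ := lt_min_iff.1 hbm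
  have hdir : ∀ k, ∀ t ∈ Set.Ioc 0 b, ∀ d,
      d ∈ directions (φ k t) ↔ d = map (φ k) (𝓝[>] t) ∨ d = map (φ k) (𝓝[<] t) := by
    intro k t ht d
    have htr : t ∈ Set.Ico 0 r := ⟨ht.1.le, ht.2.trans_lt hbr⟩
    -- Inside the star, this radius around `φ k t` meets branch `k` alone: points of other branches
    -- are at distance at least `t`.
    have hδ : 0 < min t (r - t) := lt_min ht.1 (sub_pos.2 htr.2)
    have hIoo : ∀ s ∈ Set.Ioo (t - min t (r - t)) (t + min t (r - t)), s ∈ Set.Ico 0 r :=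
      fun s hs => ⟨by linarith [hs.1, min_le_left t (r - t)],
        by linarith [hs.2, min_le_right t (r - t)]⟩
    have hN : (⋃ k, φ k '' Set.Ico 0 r) ∈ 𝓝 (φ k t) := by
      refine mem_interior_iff_mem_nhds.1 (hsub _ ?_)
      rw [h.edist_center k htr]
      exact (ENNReal.ofReal_lt_ofReal_iff hε).2 (ht.2.trans_lt hbε)
    have hball := RealTropical.eball_mem_nhds (p := φ k t) (mem_of_superset hN fun x hx => by
      obtain ⟨l, s, hs, rfl⟩ := Set.mem_iUnion.1 hx
      by_cases hl : l = k
      · subst hl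
        simp [h.edist_same l s hs t htr]
      · simp [h.edist_ne l k hl s hs t htr]) hδ
    refine mem_directions_of_geodesic hδ
      (fun s hs u hu => h.edist_same k s (hIoo s hs) u (hIoo u hu)) ?_
    filter_upwards [hN, hball] with x hx hxd
    obtain ⟨l, s, hs, rfl⟩ := Set.mem_iUnion.1 hx
    by_cases hl : l = k
    · subst hl
      rw [h.edist_same l s hs t htr] at hxd
      have := abs_lt.1 ((ENNReal.ofReal_lt_ofReal_iff hδ).1 hxd)
      exact ⟨s, ⟨by linarith [this.1], by linarith [this.2]⟩, rfl⟩
    · rw [h.edist_ne l k hl s hs t htr] at hxd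
      have := (ENNReal.ofReal_lt_ofReal_iff hδ).1 hxd
      linarith [min_le_left t (r - t), hs.1]
  have hIcc : ∀ k, ∀ s ∈ Set.Icc 0 b, ∀ t ∈ Set.Icc 0 b,
      edist (φ k s) (φ k t) = ENNReal.ofReal |s - t| := fun k s hs t ht =>
    h.edist_same k s ⟨hs.1, hs.2.trans_lt hbr⟩ t ⟨ht.1, ht.2.trans_lt hbr⟩
  refine ⟨b, hb, hbr, fun k => ⟨continuousOn_of_edist (hIcc k), injOn_of_edist (hIcc k), ?_,
    fun t ht => (hdir k t ht _).2 (Or.inr rfl),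
    fun t ht d => (hdir k t ⟨ht.1, ht.2.le⟩ d).1, ?_⟩⟩
  · intro t ht
    rcases eq_or_lt_of_le ht.1 with rfl | h0
    · rw [h.center, h.mem_directions_iff]
      exact ⟨k, rfl⟩
    · exact (hdir k t ⟨h0, ht.2.le⟩ _).2 (Or.inl rfl)
  · intro s t u h1 h2 h3 h4
    rw [hIcc k s ⟨h1.le, by linarith⟩ u ⟨by linarith, by linarith⟩,
      hIcc k s ⟨h1.le, by linarith⟩ t ⟨by linarith, by linarith⟩,
      hIcc k t ⟨by linarith, by linarith⟩ u ⟨by linarith, by linarith⟩,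
      ENNReal.toReal_ofReal (abs_nonneg _), ENNReal.toReal_ofReal (abs_nonneg _),
      ENNReal.toReal_ofReal (abs_nonneg _), abs_of_neg (by linarith), abs_of_neg (by linarith),
      abs_of_neg (by linarith)]
    ring

theorem ofReal_image_Ioo {s : ℝ} (hs : 0 ≤ s) (u : ℝ) :
    ENNReal.ofReal '' Set.Ioo s u = Set.Ioo (ENNReal.ofReal s) (ENNReal.ofReal u) := by
  ext x
  constructor
  · rintro ⟨t, ht, rfl⟩
    have h1 : 0 < t := hs.trans_lt ht.1
    exact ⟨(ENNReal.ofReal_lt_ofReal_iff h1).2 ht.1,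
      (ENNReal.ofReal_lt_ofReal_iff (h1.trans ht.2)).2 ht.2⟩
  · intro hx
    have hx' : x ≠ ∞ := (hx.2.trans ENNReal.ofReal_lt_top).ne
    refine ⟨x.toReal, ?_, ENNReal.ofReal_toReal hx'⟩
    rw [← ENNReal.ofReal_toReal hx'] at hx
    exact ⟨(ENNReal.ofReal_lt_ofReal_iff_of_nonneg hs).1 hx.1,
      (ENNReal.ofReal_lt_ofReal_iff_of_nonneg ENNReal.toReal_nonneg).1 hx.2⟩

theorem map_ofReal_nhdsGT {t : ℝ} (ht : 0 < t) :
    map ENNReal.ofReal (𝓝[>] t) = 𝓝[>] (ENNReal.ofReal t) := by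
  refine le_antisymm ?_ fun S hS => ?_
  · refine ENNReal.continuous_ofReal.continuousWithinAt.tendsto_nhdsWithin fun s hs => ?_
    exact (ENNReal.ofReal_lt_ofReal_iff (ht.trans hs)).2 hs
  · obtain ⟨u, hu, hsub⟩ := mem_nhdsGT_iff_exists_Ioo_subset.1 (mem_map.1 hS)
    refine mem_of_superset (Ioo_mem_nhdsGT
      ((ENNReal.ofReal_lt_ofReal_iff (ht.trans hu)).2 hu)) ?_
    rw [← ofReal_image_Ioo ht.le]
    exact Set.image_subset_iff.2 hsub

theorem map_ofReal_nhdsLT {t : ℝ} (ht : 0 < t) :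
    map ENNReal.ofReal (𝓝[<] t) = 𝓝[<] (ENNReal.ofReal t) := by
  refine le_antisymm ?_ fun S hS => ?_
  · refine ENNReal.continuous_ofReal.continuousWithinAt.tendsto_nhdsWithin fun s hs => ?_
    exact (ENNReal.ofReal_lt_ofReal_iff ht).2 hs
  · obtain ⟨u, ⟨hu0, hu⟩, hsub⟩ := (mem_nhdsLT_iff_exists_mem_Ico_Ioo_subset ht).1 (mem_map.1 hS)
    refine mem_of_superset (Ioo_mem_nhdsLT ((ENNReal.ofReal_lt_ofReal_iff ht).2 hu)) ?_
    rw [← ofReal_image_Ioo hu0]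
    exact Set.image_subset_iff.2 hsub

theorem IsUnboundedEdge.edist_ofReal {φ : ℝ≥0∞ → T} (h : IsUnboundedEdge φ) {s t : ℝ} (hs : 0 ≤ s)
    (ht : 0 ≤ t) : edist (φ (ENNReal.ofReal s)) (φ (ENNReal.ofReal t)) = ENNReal.ofReal |s - t| := by
  rw [h.edist_eq, RealTropical.edist_ofReal hs ht]

variable [T2Space T]

theorem IsUnboundedEdge.mem_directions_iff {φ : ℝ≥0∞ → T} (h : IsUnboundedEdge φ) {t : ℝ≥0∞}
    (ht : 0 < t) (ht' : t ≠ ∞) {d : Filter T} :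
    d ∈ directions (φ t) ↔ d = map φ (𝓝[>] t) ∨ d = map φ (𝓝[<] t) := by
  have h0 : 0 < t.toReal := ENNReal.toReal_pos ht.ne' ht'
  rw [← ENNReal.ofReal_toReal ht', ← map_ofReal_nhdsGT h0, ← map_ofReal_nhdsLT h0, map_map, map_map]
  refine mem_directions_of_geodesic (γ := φ ∘ ENNReal.ofReal) h0 (fun s hs u hu => ?_) ?_
  · rw [sub_self] at hs hu
    exact h.edist_ofReal hs.1.le hu.1.le
  · rw [Set.image_comp, sub_self, ofReal_image_Ioo le_rfl, Function.comp_apply,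
      ENNReal.ofReal_toReal ht', ← h.map_nhds ht]
    refine image_mem_map (isOpen_Ioo.mem_nhds ⟨by simpa using ht, ?_⟩)
    rw [ENNReal.lt_ofReal_iff_toReal_lt ht']
    linarith

/-- An unbounded edge without its finite end is an arc. -/
theorem IsUnboundedEdge.isArc {φ : ℝ≥0∞ → T} (h : IsUnboundedEdge φ) : IsArc φ 1 ∞ where
  continuousOn := h.continuous.continuousOn
  injOn := h.injective.injOn
  right t ht := (h.mem_directions_iff (one_pos.trans_le ht.1) ht.2.ne).2 (Or.inl rfl)
  left t ht := by
    by_cases h' : t = ∞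
    · rw [h', h.directions_top, ← h.map_nhdsNE_top, Set.Iio_top, Finset.mem_singleton]
    · exact (h.mem_directions_iff (one_pos.trans ht.1) h').2 (Or.inr rfl)
  eq_or t ht d := (h.mem_directions_iff (one_pos.trans ht.1) ht.2.ne).1
  edist_add s t u _ h2 h3 h4 := by
    have hu : u ≠ ∞ := h4.ne
    have ht : t ≠ ∞ := (h3.trans h4).ne
    have hs : s ≠ ∞ := (h2.trans (h3.trans h4)).ne
    have e2 := (ENNReal.toReal_lt_toReal hs ht).2 h2
    have e3 := (ENNReal.toReal_lt_toReal ht hu).2 h3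
    rw [← ENNReal.ofReal_toReal hu, ← ENNReal.ofReal_toReal hs, ← ENNReal.ofReal_toReal ht]
    simp only [h.edist_ofReal ENNReal.toReal_nonneg ENNReal.toReal_nonneg,
      ENNReal.toReal_ofReal (abs_nonneg _)]
    rw [abs_of_neg (by linarith), abs_of_neg (by linarith), abs_of_neg (by linarith)]
    ring

variable {g : T → ℝ}

theorem IsStarOrEnd.exists_mem_isBalanced_inter (hT : IsStarOrEnd T) (hg : IsPiecewiseAffine g)
    {p : T} {d : Filter T} (hd : d ∈ directions p) :
    ∃ A ∈ d, IsTame A ∧ ∀ K, IsTame K → IsBalanced g (K ∩ A) := by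
  rcases hT p with ⟨n, r, φ, h⟩ | ⟨φ, h, rfl⟩
  · obtain ⟨k, rfl⟩ := h.mem_directions_iff.1 hd
    obtain ⟨b, hb, -, harc⟩ := h.exists_isArc
    exact ⟨_, image_mem_map (Ioo_mem_nhdsGT hb), (harc k).isTame hT,
      fun K hK => (harc k).isBalanced_inter hT hg hK hb⟩
  · rw [h.directions_top, Finset.mem_singleton] at hd
    rw [hd, ← h.map_nhdsNE_top, ← Set.Iio_top]
    exact ⟨_, image_mem_map (Ioo_mem_nhdsLT ENNReal.one_lt_top), h.isArc.isTame hT,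
      fun K hK => h.isArc.isBalanced_inter hT hg hK ENNReal.one_lt_top⟩

/-- To avoid counting the overlap twice, `B` is tested against `K ∩ Aᶜ`, which is again tame. For
this reason the local property quantifies over all tame `K`. -/
theorem IsStarOrEnd.isBalanced_inter_union (hT : IsStarOrEnd T) {A B : Set T} (hA : IsTame A)
    (hAb : ∀ K, IsTame K → IsBalanced g (K ∩ A)) (hBb : ∀ K, IsTame K → IsBalanced g (K ∩ B))
    {K : Set T} (hK : IsTame K) : IsBalanced g (K ∩ (A ∪ B)) := by
  have e : K ∩ (A ∪ B) = K ∩ A ∪ (K ∩ Aᶜ) ∩ B := by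
    ext x
    simp only [Set.mem_inter_iff, Set.mem_union, Set.mem_compl_iff]
    tauto
  rw [e, hT.isBalanced_union_iff (hK.inter hA) _ (hAb K hK)]
  · exact hBb _ (hK.inter hA.compl)
  · exact Set.disjoint_left.2 fun x hx hx' => hx'.1.2 hx.2

/-- On a compact space, the slopes in the directions contained in a tame set sum up to zero. -/
theorem IsStarOrEnd.isBalanced [CompactSpace T] (hT : IsStarOrEnd T) (hg : IsPiecewiseAffine g)
    {K : Set T} (hK : IsTame K) : IsBalanced g K := by
  have key : ∃ A : Set T, Set.univ ⊆ A ∧ IsTame A ∧ ∀ K, IsTame K → IsBalanced g (K ∩ A) := by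
    refine isCompact_univ.induction_on
      (p := fun S => ∃ A : Set T, S ⊆ A ∧ IsTame A ∧ ∀ K, IsTame K → IsBalanced g (K ∩ A)) ?_ ?_ ?_ ?_
    · exact ⟨∅, Set.Subset.rfl, isTame_empty, fun K _ => isBalanced_of_flux_eq_zero fun p =>
        flux_eq_zero fun d hd h => (hT.neBot hd).ne (empty_mem_iff_bot.1 (Set.inter_empty K ▸ h))⟩
    · rintro S S' hSS' ⟨A, hA⟩
      exact ⟨A, hSS'.trans hA.1, hA.2⟩
    · rintro S S' ⟨A, hSA, hA, hAb⟩ ⟨B, hSB, hB, hBb⟩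
      exact ⟨A ∪ B, Set.union_subset_union hSA hSB, hA.union hB,
        fun K hK => hT.isBalanced_inter_union hA hAb hBb hK⟩
    · intro p _
      -- A neighbourhood of `p` is assembled from `{p}` and one arc for each direction.
      have hfin : ∀ s : Finset (Filter T), s ⊆ directions p → ∃ A : Set T, p ∈ A ∧
          (∀ d ∈ s, A ∈ d) ∧ IsTame A ∧ ∀ K, IsTame K → IsBalanced g (K ∩ A) := by
        classical
        intro s
        induction s using Finset.induction_on with
        | empty =>
          exact fun _ => ⟨{p}, rfl, by simp, hT.isTame_singleton p,
            fun K _ => hT.isBalanced_of_subset_singleton Set.inter_subset_right⟩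
        | insert d s _ ih =>
          intro hs
          obtain ⟨A, hpA, hAs, hA, hAb⟩ := ih ((Finset.subset_insert _ _).trans hs)
          obtain ⟨B, hBd, hB, hBb⟩ :=
            hT.exists_mem_isBalanced_inter hg (hs (Finset.mem_insert_self _ _))
          refine ⟨A ∪ B, Or.inl hpA, fun d' hd' => ?_, hA.union hB,
            fun K hK => hT.isBalanced_inter_union hA hAb hBb hK⟩
          rcases Finset.mem_insert.1 hd' with rfl | h'
          · exact mem_of_superset hBd Set.subset_union_right
          · exact mem_of_superset (hAs d' h') Set.subset_union_left
      obtain ⟨A, hpA, hAd, hA⟩ := hfin _ Finset.Subset.rfl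
      refine ⟨A, nhdsWithin_le_nhds ?_, A, Set.Subset.rfl, hA⟩
      rw [← pure_sup_nhdsNE]
      exact ⟨hpA, hT.mem_nhdsNE_iff.2 hAd⟩
  obtain ⟨A, huniv, -, hA⟩ := key
  have := hA K hK
  rwa [Set.univ_subset_iff.1 huniv, Set.inter_univ] at this

end Charts

/-! ### The maximum principle. -/

section Harmonic

variable {T : Type*} [TopologicalSpace T] [WeakEMetricSpace T]

/-- All the slopes of `g` exist, and `g` is continuous at the points which have a star-shaped
neighbourhood. -/
def IsStarAffine (g : T → ℝ) : Prop :=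
  ∀ p : T, ∀ d ∈ directions p, ∃ m, HasGermSlope g d m ∧
    (HasStarNeighbourhood p → ∀ᶠ x in d, g x = g p + m * (edist x p).toReal)

theorem IsStarAffine.isPiecewiseAffine {g : T → ℝ} (hg : IsStarAffine g) : IsPiecewiseAffine g :=
  fun p d hd => (hg p d hd).imp fun _ h => h.1

theorem IsStarChart.tendsto_toReal_edist {p : T} {n : ℕ} {r : ℝ} {φ : Fin n → ℝ → T}
    (h : IsStarChart p r φ) {d : Filter T} (hd : d ∈ directions p) :
    Tendsto (fun x => (edist x p).toReal) d (𝓝[>] 0) := by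
  obtain ⟨k, rfl⟩ := h.mem_directions_iff.1 hd
  rw [tendsto_map'_iff]
  refine tendsto_id.congr' ?_
  filter_upwards [h.Ioo_mem] with t ht
  rw [Function.comp_apply, h.edist_center k ⟨ht.1.le, ht.2⟩, ENNReal.toReal_ofReal ht.1.le, id]

variable [T2Space T] {g : T → ℝ}

theorem IsStarAffine.eventually_eq (hT : IsStarOrEnd T) (hg : IsStarAffine g) {p : T}
    {d : Filter T} (hd : d ∈ directions p) (hp : HasStarNeighbourhood p) :
    ∀ᶠ x in d, g x = g p + germSlope g d * (edist x p).toReal := by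
  obtain ⟨m, hm, h⟩ := hg p d hd
  rw [hm.germSlope_eq hT hd]
  exact h hp

/-- A superlevel set contains the directions at a higher point and the ascending directions at a
point of the level, and avoids the other ones. -/
theorem IsStarAffine.superlevel_mem_or (hT : IsStarOrEnd T) (hg : IsStarAffine g) {p : T}
    {d : Filter T} (hd : d ∈ directions p) (hp : HasStarNeighbourhood p) (c : ℝ) :
    ((c < g p ∨ c = g p ∧ 0 < germSlope g d) ∧ {x | c < g x} ∈ d) ∨
      (¬ (c < g p ∨ c = g p ∧ 0 < germSlope g d) ∧ {x | c < g x}ᶜ ∈ d) := by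
  have h := hg.eventually_eq hT hd hp
  obtain ⟨n, r, φ, hφ⟩ := hp
  have ht := hφ.tendsto_toReal_edist hd
  have ht0 : Tendsto (fun x => g p + germSlope g d * (edist x p).toReal) d (𝓝 (g p)) := by
    simpa using ((tendsto_nhds_of_tendsto_nhdsWithin ht).const_mul
      (germSlope g d : ℝ)).const_add (g p)
  have hpos : ∀ᶠ x in d, 0 < (edist x p).toReal := ht self_mem_nhdsWithin
  rcases lt_trichotomy c (g p) with hc | rfl | hc
  · refine Or.inl ⟨Or.inl hc, ?_⟩
    filter_upwards [h, ht0.eventually_const_lt hc] with x hx hx'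
    rwa [← hx] at hx'
  · by_cases hm : 0 < germSlope g d
    · refine Or.inl ⟨Or.inr ⟨rfl, hm⟩, ?_⟩
      filter_upwards [h, hpos] with x hx hx'
      have : (0 : ℝ) < germSlope g d := by exact_mod_cast hm
      have := mul_pos this hx'
      show g p < g x
      linarith
    · refine Or.inr ⟨by simp [hm], ?_⟩
      filter_upwards [h, hpos] with x hx hx'
      have : (germSlope g d : ℝ) ≤ 0 := by exact_mod_cast not_lt.1 hm
      have := mul_nonpos_of_nonpos_of_nonneg this hx'.le
      show ¬ g p < g x
      linarith
  · refine Or.inr ⟨by rintro (h' | h') <;> linarith [h'], ?_⟩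
    filter_upwards [h, ht0.eventually_lt_const hc] with x hx hx'
    rw [← hx] at hx'
    exact hx'.not_gt

/-- A harmonic function has no nonzero slopes. -/
theorem IsStarAffine.germSlope_eq_zero [CompactSpace T] (hT : IsStarOrEnd T) (hg : IsStarAffine g)
    (hsum : ∀ p, ∑ d ∈ directions p, germSlope g d = 0) {p : T} {d : Filter T}
    (hd : d ∈ directions p) : germSlope g d = 0 := by
  classical
  -- An infinite end has a single direction, so harmonicity makes its slope vanish.
  have hend : ∀ q : T, ¬ HasStarNeighbourhood q → ∀ d ∈ directions q, germSlope g d = 0 := by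
    intro q hq d hd
    obtain ⟨φ, h, rfl⟩ := (hT q).resolve_left hq
    have := hsum (φ ∞)
    rw [h.directions_top, Finset.sum_singleton] at this
    rw [h.directions_top, Finset.mem_singleton] at hd
    rwa [hd]
  by_cases hp : HasStarNeighbourhood p
  swap
  · exact hend p hp d hd
  have htame : IsTame {x | g p < g x} := by
    intro q d hd
    by_cases hq : HasStarNeighbourhood q
    · exact (hg.superlevel_mem_or hT hd hq (g p)).imp And.right And.right
    · have := hT.neBot hd
      obtain ⟨m, hm, -⟩ := hg q d hd
      rw [← hm.germSlope_eq hT hd, hend q hq d hd] at hm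
      obtain ⟨c, hc⟩ := hm.eventually_eq_const
      by_cases hcp : g p < c
      · exact Or.inl (hc.mono fun x hx => show g p < g x by rwa [hx])
      · exact Or.inr (hc.mono fun x hx => show ¬ g p < g x by rwa [hx])
  have hmem : ∀ q, HasStarNeighbourhood q → ∀ d ∈ directions q,
      ({x | g p < g x} ∈ d ↔ g p < g q ∨ g p = g q ∧ 0 < germSlope g d) := by
    intro q hq d hd
    rcases hg.superlevel_mem_or hT hd hq (g p) with ⟨h1, h2⟩ | ⟨h1, h2⟩
    · exact iff_of_true h2 h1
    · exact iff_of_false (hT.notMem_of_disjoint hd disjoint_compl_left h2) h1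
  -- Above the level all directions count and their slopes cancel; on the level only ascending ones
  -- count; below it none do. As the total flux is zero, `p` has no ascending direction, and then no
  -- descending one.
  have hnonneg : ∀ q, 0 ≤ flux g {x | g p < g x} q := by
    intro q
    by_cases hq : HasStarNeighbourhood q
    · by_cases hpq : g p < g q
      · rw [flux, Finset.sum_congr rfl fun d hd => if_pos ((hmem q hq d hd).2 (Or.inl hpq)), hsum]
      · refine Finset.sum_nonneg fun d hd => ?_
        split_ifs with h
        · exact (((hmem q hq d hd).1 h).resolve_left hpq).2.le
        · exact le_rfl
    · refine Finset.sum_nonneg fun d hd => ?_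
      rw [hend q hq d hd, ite_self]
  obtain ⟨hfin, hzero⟩ := hT.isBalanced hg.isPiecewiseAffine htame
  have hflux : flux g {x | g p < g x} p ≤ 0 := by
    rw [← hzero]
    exact single_le_finsum p hfin hnonneg
  have hnonpos : ∀ d ∈ directions p, germSlope g d ≤ 0 := by
    intro d hd
    by_contra! hm
    have hle : germSlope g d ≤ flux g {x | g p < g x} p := by
      rw [← if_pos (c := {x | g p < g x} ∈ d) (t := germSlope g d) (e := 0)
        ((hmem p hp d hd).2 (Or.inr ⟨rfl, hm⟩))]
      refine Finset.single_le_sum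
        (f := fun d => if {x | g p < g x} ∈ d then germSlope g d else 0) (fun d hd => ?_) hd
      split_ifs with h
      · exact (((hmem p hp d hd).1 h).resolve_left (lt_irrefl _)).2.le
      · exact le_rfl
    linarith
  exact (Finset.sum_eq_zero_iff_of_nonpos hnonpos).1 (hsum p) d hd

theorem IsStarOrEnd.neBot_nhdsNE (hT : IsStarOrEnd T) (p : T) : (𝓝[≠] p).NeBot := by
  obtain ⟨d, hd⟩ : (directions p).Nonempty := by
    rcases hT p with ⟨n, r, φ, h⟩ | ⟨φ, h, rfl⟩
    · exact ⟨_, h.mem_directions_iff.2 ⟨⟨0, h.valence_pos⟩, rfl⟩⟩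
    · exact ⟨_, by rw [h.directions_top, Finset.mem_singleton]⟩
  have := hT.neBot hd
  exact NeBot.mono this (hT.le_nhdsNE hd)

/-- A harmonic function on a compact connected space is constant. -/
theorem IsStarAffine.exists_eventually_eq [CompactSpace T] [PreconnectedSpace T]
    (hT : IsStarOrEnd T) (hg : IsStarAffine g)
    (hsum : ∀ p, ∑ d ∈ directions p, germSlope g d = 0) (p₀ : T) :
    ∃ c, ∀ p, ∀ᶠ x in 𝓝[≠] p, g x = c := by
  have hloc : ∀ p, ∃ c, ∀ᶠ x in 𝓝[≠] p, g x = c := by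
    intro p
    by_cases hp : HasStarNeighbourhood p
    · refine ⟨g p, hT.mem_nhdsNE_iff.2 fun d hd => ?_⟩
      filter_upwards [hg.eventually_eq hT hd hp] with x hx
      simpa [hg.germSlope_eq_zero hT hsum hd] using hx
    · obtain ⟨φ, h, rfl⟩ := (hT p).resolve_left hp
      have hd : 𝓝[≠] (φ ∞) ∈ directions (φ ∞) := by rw [h.directions_top, Finset.mem_singleton]
      have := hT.neBot hd
      obtain ⟨m, hm, -⟩ := hg _ _ hd
      rw [← hm.germSlope_eq hT hd, hg.germSlope_eq_zero hT hsum hd] at hm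
      exact hm.eventually_eq_const
  choose c hc using hloc
  -- For `y ≠ p` near `p`, a punctured neighbourhood of `p` is a full neighbourhood of `y`, so the
  -- constants at `p` and `y` agree at a common point.
  have hconst : IsLocallyConstant c := by
    refine (IsLocallyConstant.iff_eventually_eq c).2 fun p => ?_
    rw [← pure_sup_nhdsNE, eventually_sup]
    refine ⟨rfl, ?_⟩
    filter_upwards [eventually_eventually_nhdsWithin.2 (hc p), self_mem_nhdsWithin] with y hy hyp
    rw [nhdsWithin_eq_nhds.2 (isOpen_compl_singleton.mem_nhds hyp)] at hy
    have := hT.neBot_nhdsNE y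
    obtain ⟨x, hx, hx'⟩ := ((hc y).and (hy.filter_mono nhdsWithin_le_nhds)).exists
    exact hx.symm.trans hx'
  exact ⟨c p₀, fun p => by rw [hconst.apply_eq_of_preconnectedSpace p₀ p]; exact hc p⟩

end Harmonic

/-! ### From rational functions to germ slopes. -/

section RationalFunctions

variable {T : Type*} [TopologicalSpace T] [WeakEMetricSpace T] {f : T → EReal}

theorem IsStarChart.hasGermSlope {p : T} {n : ℕ} {r : ℝ} {φ : Fin n → ℝ → T}
    (h : IsStarChart p r φ) {k : Fin n} {m : ℤ} (hm : HasSlope f (φ k) m) :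
    HasGermSlope (fun x => (f x).toReal) (map (φ k) (𝓝[>] 0)) m ∧
      ∀ᶠ x in map (φ k) (𝓝[>] 0), (f x).toReal = (f p).toReal + m * (edist x p).toReal := by
  obtain ⟨y, hy⟩ := hm
  have hy' := hy.filter_mono (nhdsWithin_mono _ Set.Ioi_subset_Ici_self)
  have h0 : f p = ((y + m * (0 : ℝ) : ℝ) : EReal) := by
    rw [← h.center k]
    exact hy.self_of_nhdsWithin Set.self_mem_Ici
  constructor
  · simp only [HasGermSlope, eventually_map]
    filter_upwards [hy', h.Ioo_mem] with t ht htr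
    filter_upwards [hy', Ioo_mem_nhdsGT htr.1] with s hs hst
    rw [ht, hs, h.edist_same k s ⟨hst.1.le, hst.2.trans htr.2⟩ t ⟨htr.1.le, htr.2⟩,
      ENNReal.toReal_ofReal (abs_nonneg _), abs_of_neg (sub_neg.2 hst.2), EReal.toReal_coe,
      EReal.toReal_coe]
    ring
  · rw [eventually_map]
    filter_upwards [hy', h.Ioo_mem] with t ht htr
    rw [ht, h0, h.edist_center k ⟨htr.1.le, htr.2⟩, ENNReal.toReal_ofReal htr.1.le,
      EReal.toReal_coe, EReal.toReal_coe]
    ring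

theorem map_ofReal_atTop : map ENNReal.ofReal atTop = 𝓝[≠] (∞ : ℝ≥0∞) := by
  refine le_antisymm ?_ fun S hS => ?_
  · exact tendsto_nhdsWithin_iff.2 ⟨ENNReal.tendsto_ofReal_atTop,
      Eventually.of_forall fun t => ENNReal.ofReal_ne_top⟩
  · obtain ⟨R, hR⟩ := mem_atTop_sets.1 (mem_map.1 hS)
    rw [← Set.Iio_top]
    filter_upwards [Ioo_mem_nhdsLT (ENNReal.ofReal_lt_top (r := R))] with x hx
    rw [← ENNReal.ofReal_toReal hx.2.ne]
    exact hR _ ((ENNReal.ofReal_le_iff_le_toReal hx.2.ne).1 hx.1.le)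

/-- The sign changes because a germ slope is measured away from the infinite end. -/
theorem IsUnboundedEdge.hasGermSlope [T2Space T] {φ : ℝ≥0∞ → T} (h : IsUnboundedEdge φ) {m : ℤ}
    (hm : HasSlopeTowardsInfinity f φ m) :
    HasGermSlope (fun x => (f x).toReal) (𝓝[≠] (φ ∞)) (-m) := by
  obtain ⟨y, hy⟩ := hm
  rw [← h.map_nhdsNE_top, ← map_ofReal_atTop]
  simp only [HasGermSlope, eventually_map]
  filter_upwards [hy, eventually_ge_atTop 0] with t ht ht0
  filter_upwards [hy, eventually_ge_atTop t] with s hs hst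
  rw [ht, hs, h.edist_ofReal (ht0.trans hst) ht0, ENNReal.toReal_ofReal (abs_nonneg _),
    abs_of_nonneg (sub_nonneg.2 hst), EReal.toReal_coe, EReal.toReal_coe]
  push_cast
  ring

variable [T2Space T]

/-- `EReal.toReal` sends `±∞` to `0`. This is harmless, since at infinite ends `IsStarAffine`
ignores the value. -/
theorem IsRationalFunction.isStarAffine (hT : IsStarOrEnd T) (hf : IsRationalFunction f) :
    IsStarAffine fun x => (f x).toReal := by
  intro p d hd
  rcases hT p with ⟨n, r, φ, h⟩ | ⟨φ, h, rfl⟩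
  · obtain ⟨k, rfl⟩ := h.mem_directions_iff.1 hd
    obtain ⟨m, hm⟩ := hf.slope p n r φ h k
    exact ⟨m, (h.hasGermSlope hm).1, fun _ => (h.hasGermSlope hm).2⟩
  · obtain ⟨m, hm⟩ := hf.slope_end φ h
    rw [h.directions_top, Finset.mem_singleton] at hd
    rw [hd]
    exact ⟨-m, h.hasGermSlope hm, fun h' => absurd h' h.not_hasStarNeighbourhood⟩

theorem HasSlopeSum.sum_germSlope (hT : IsStarOrEnd T) {p : T} {a : ℤ} (h : HasSlopeSum f p a) :
    ∑ d ∈ directions p, germSlope (fun x => (f x).toReal) d = a := by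
  rcases h with ⟨n, r, φ, m, h, hm, rfl⟩ | ⟨φ, m, h, rfl, hm, rfl⟩
  · rw [h.directions_eq, Finset.sum_map]
    exact Finset.sum_congr rfl fun k _ =>
      (h.hasGermSlope (hm k)).1.germSlope_eq hT (h.mem_directions_iff.2 ⟨k, rfl⟩)
  · rw [h.directions_top, Finset.sum_singleton]
    exact (h.hasGermSlope hm).germSlope_eq hT (by rw [h.directions_top, Finset.mem_singleton])

end RationalFunctions

/-! ### The real structure acting on directions; real components. -/

section RealStructures

variable {T : Type*} [TopologicalSpace T] [WeakEMetricSpace T] (ι : RealStructure T)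

namespace RealStructure

theorem edist_apply (p q : T) : edist (ι.toHomeomorph p) (ι.toHomeomorph q) = edist p q :=
  ι.edist_map p q

@[simp]
theorem apply_apply (p : T) : ι.toHomeomorph (ι.toHomeomorph p) = p :=
  ι.involutive p

theorem map_map_self (d : Filter T) : map ι.toHomeomorph (map ι.toHomeomorph d) = d := by
  rw [map_map, show ι.toHomeomorph ∘ ι.toHomeomorph = id from funext ι.apply_apply, map_id]

theorem isStarChart {p : T} {n : ℕ} {r : ℝ} {φ : Fin n → ℝ → T} (h : IsStarChart p r φ) :
    IsStarChart (ι.toHomeomorph p) r fun k t => ι.toHomeomorph (φ k t) where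
  valence_pos := h.valence_pos
  radius_pos := h.radius_pos
  center k := by rw [h.center]
  edist_same k s hs t ht := by rw [edist_apply, h.edist_same k s hs t ht]
  edist_ne k l hkl s hs t ht := by rw [edist_apply, h.edist_ne k l hkl s hs t ht]
  mem_nhds := by
    refine mem_of_superset (ι.toHomeomorph.isOpenMap.image_mem_nhds h.mem_nhds) ?_
    rw [Set.image_iUnion]
    exact Set.iUnion_mono fun k => by rw [← Set.image_comp]; rfl

theorem hasStarNeighbourhood {p : T} (h : HasStarNeighbourhood p) :
    HasStarNeighbourhood (ι.toHomeomorph p) := by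
  obtain ⟨n, r, φ, h⟩ := h
  exact ⟨n, r, _, ι.isStarChart h⟩

theorem isUnboundedEdge {φ : ℝ≥0∞ → T} (h : IsUnboundedEdge φ) :
    IsUnboundedEdge fun t => ι.toHomeomorph (φ t) where
  continuous := ι.toHomeomorph.continuous.comp h.continuous
  edist_eq s t := by rw [edist_apply, h.edist_eq]
  isOpen := by
    rw [show (fun t => ι.toHomeomorph (φ t)) = ι.toHomeomorph ∘ φ from rfl, Set.image_comp]
    exact ι.toHomeomorph.isOpenMap _ h.isOpen

theorem map_nhdsNE (p : T) : map ι.toHomeomorph (𝓝[≠] p) = 𝓝[≠] (ι.toHomeomorph p) := by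
  rw [ι.toHomeomorph.isEmbedding.map_nhdsWithin_eq, Set.image_compl_eq ι.toHomeomorph.bijective,
    Set.image_singleton]

theorem hasGermSlope_comp_iff {g : T → ℝ} {d : Filter T} {m : ℤ} :
    HasGermSlope (fun x => g (ι.toHomeomorph x)) d m ↔
      HasGermSlope g (map ι.toHomeomorph d) m := by
  simp only [HasGermSlope, eventually_map, edist_apply]

variable [T2Space T] {p : T} {d : Filter T}

theorem map_mem_directions (hT : IsStarOrEnd T) (hd : d ∈ directions p) :
    map ι.toHomeomorph d ∈ directions (ι.toHomeomorph p) := by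
  rcases hT p with ⟨n, r, φ, h⟩ | ⟨φ, h, rfl⟩
  · obtain ⟨k, rfl⟩ := h.mem_directions_iff.1 hd
    exact (ι.isStarChart h).mem_directions_iff.2 ⟨k, (map_map ..).symm⟩
  · rw [h.directions_top, Finset.mem_singleton] at hd
    rw [(ι.isUnboundedEdge h).directions_top, Finset.mem_singleton, hd, ι.map_nhdsNE]

theorem isStarAffine_comp (hT : IsStarOrEnd T) {g : T → ℝ} (hg : IsStarAffine g) :
    IsStarAffine fun x => g (ι.toHomeomorph x) := by
  intro p d hd
  obtain ⟨m, hm, hs⟩ := hg _ _ (ι.map_mem_directions hT hd)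
  refine ⟨m, ι.hasGermSlope_comp_iff.2 hm, fun hp => ?_⟩
  have := hs (ι.hasStarNeighbourhood hp)
  simpa only [eventually_map, edist_apply] using this

theorem sum_directions (hT : IsStarOrEnd T) (s : Filter T → ℤ) (p : T) :
    ∑ d ∈ directions p, s (map ι.toHomeomorph d) = ∑ d ∈ directions (ι.toHomeomorph p), s d := by
  refine Finset.sum_bij' (fun d _ => map ι.toHomeomorph d) (fun d _ => map ι.toHomeomorph d)
    (fun d hd => ι.map_mem_directions hT hd) (fun d hd => ?_) (fun d _ => ι.map_map_self d)
    (fun d _ => ι.map_map_self d) (fun _ _ => rfl)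
  simpa using ι.map_mem_directions hT hd

/-- If the divisor of `g` is real, then `g` is invariant under the real structure. -/
theorem eventually_eq_comp [CompactSpace T] [PreconnectedSpace T] (hT : IsStarOrEnd T) {g : T → ℝ}
    (hg : IsStarAffine g) (hsum : ∀ p, ∑ d ∈ directions (ι.toHomeomorph p), germSlope g d =
      ∑ d ∈ directions p, germSlope g d) (p : T) :
    ∀ᶠ x in 𝓝[≠] p, g x = g (ι.toHomeomorph x) := by
  have hg' := ι.isStarAffine_comp hT hg
  have hslope : ∀ p, ∀ d ∈ directions p,
      germSlope (fun x => g x - g (ι.toHomeomorph x)) d =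
        germSlope g d - germSlope g (map ι.toHomeomorph d) := by
    intro p d hd
    obtain ⟨m, hm, -⟩ := hg p d hd
    obtain ⟨m', hm', -⟩ := hg' p d hd
    rw [(hm.sub hm').germSlope_eq hT hd, hm.germSlope_eq hT hd,
      (ι.hasGermSlope_comp_iff.1 hm').germSlope_eq hT (ι.map_mem_directions hT hd)]
  have hG : IsStarAffine fun x => g x - g (ι.toHomeomorph x) := by
    intro p d hd
    obtain ⟨m, hm, hs⟩ := hg p d hd
    obtain ⟨m', hm', hs'⟩ := hg' p d hd
    refine ⟨m - m', hm.sub hm', fun hp => ?_⟩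
    filter_upwards [hs hp, hs' hp] with x hx hx'
    rw [hx, hx']
    push_cast
    ring
  obtain ⟨c, hc⟩ := hG.exists_eventually_eq hT (fun p => by
    rw [Finset.sum_congr rfl (hslope p), Finset.sum_sub_distrib,
      ι.sum_directions hT (germSlope g), hsum, sub_self]) p
  have hcp := hc p
  -- Evaluated at `x` and at `ι x`, the difference `g - g ∘ ι` takes opposite values, both equal to
  -- `c`; so `c = 0`.
  have hcι := hc (ι.toHomeomorph p)
  rw [← ι.map_nhdsNE, eventually_map] at hcι
  have hne := hT.neBot_nhdsNE p
  obtain ⟨x, h1, h2⟩ := (hcp.and hcι).exists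
  rw [apply_apply] at h2
  filter_upwards [hcp] with x hx
  linarith

/-- Near the end `ι` is a distance-preserving map `u` of a half-line into `[0, ∞)`. Far out it is a
translation, since a reflection would take negative values; being an involution, it is the identity.
-/
theorem eventually_fixed_of_end {φ : ℝ≥0∞ → T} (h : IsUnboundedEdge φ)
    (hp : ι.toHomeomorph (φ ∞) = φ ∞) : ∀ᶠ x in 𝓝[≠] (φ ∞), ι.toHomeomorph x = x := by
  have h1 : ∀ᶠ t in atTop, ∃ s, 0 ≤ s ∧
      ι.toHomeomorph (φ (ENNReal.ofReal t)) = φ (ENNReal.ofReal s) := by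
    have : φ '' {∞}ᶜ ∈ map ι.toHomeomorph (map φ (map ENNReal.ofReal atTop)) := by
      rw [map_ofReal_atTop, h.map_nhdsNE_top, ι.map_nhdsNE, hp, ← h.map_nhdsNE_top]
      exact image_mem_map self_mem_nhdsWithin
    filter_upwards [mem_map.1 (mem_map.1 (mem_map.1 this))] with t ht
    obtain ⟨s, hs, hst⟩ := ht
    exact ⟨s.toReal, ENNReal.toReal_nonneg, by rw [ENNReal.ofReal_toReal hs, hst]⟩
  obtain ⟨M₀, hM₀⟩ := eventually_atTop.1 h1
  obtain ⟨M, hM, hM0⟩ : ∃ M, M₀ ≤ M ∧ 0 ≤ M := ⟨max M₀ 0, le_max_left _ _, le_max_right _ _⟩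
  have h2 : ∀ t, ∃ s, M ≤ t →
      0 ≤ s ∧ ι.toHomeomorph (φ (ENNReal.ofReal t)) = φ (ENNReal.ofReal s) := by
    intro t
    by_cases ht : M ≤ t
    · obtain ⟨s, hs⟩ := hM₀ t (hM.trans ht)
      exact ⟨s, fun _ => hs⟩
    · exact ⟨0, fun h' => absurd h' ht⟩
  choose u hu using h2
  have hiso : ∀ s t, M ≤ s → M ≤ t → |u s - u t| = |s - t| := by
    intro s t hs ht
    have := ι.edist_apply (φ (ENNReal.ofReal s)) (φ (ENNReal.ofReal t))
    rw [(hu s hs).2, (hu t ht).2, h.edist_ofReal (hu s hs).1 (hu t ht).1,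
      h.edist_ofReal (hM0.trans hs) (hM0.trans ht)] at this
    exact (ENNReal.ofReal_eq_ofReal_iff (abs_nonneg _) (abs_nonneg _)).1 this
  have hinv : ∀ s, M ≤ s → M ≤ u s → u (u s) = s := by
    intro s hs hus
    have := (hu (u s) hus).2
    rw [← (hu s hs).2, apply_apply] at this
    exact ((ENNReal.ofReal_eq_ofReal_iff (hM0.trans hs) (hu _ hus).1).1 (h.injective this)).symm
  have hfix : ∀ t, M ≤ t → u t = t := by
    intro t ht
    have htr : ∀ s, t + u t < s → u s = u t + (s - t) := by
      intro s hs
      have h0 := (hu t ht).1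
      have := hiso s t (by linarith) ht
      rw [abs_of_nonneg (a := s - t) (by linarith)] at this
      rcases abs_cases (u s - u t) with h3 | h3
      · linarith
      · linarith [(hu s (by linarith)).1]
    have h0 := (hu t ht).1
    have e1 := htr (t + u t + t + 1) (by linarith)
    have e2 := htr (u (t + u t + t + 1)) (by linarith)
    rw [hinv _ (by linarith) (by linarith)] at e2
    linarith
  rw [← h.map_nhdsNE_top, ← map_ofReal_atTop, eventually_map, eventually_map]
  filter_upwards [eventually_ge_atTop M] with t ht
  rw [(hu t ht).2, hfix t ht]

/-- A direction preserved by the real structure is fixed pointwise. -/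
theorem realLocus_mem_of_map_eq (hT : IsStarOrEnd T) (hp : p ∈ ι.realLocus)
    (hd : d ∈ directions p) (hmap : map ι.toHomeomorph d = d) : ι.realLocus ∈ d := by
  have hp : ι.toHomeomorph p = p := hp
  rcases hT p with ⟨n, r, φ, h⟩ | ⟨φ, h, rfl⟩
  · obtain ⟨k, rfl⟩ := h.mem_directions_iff.1 hd
    have hA : φ k '' Set.Ioo 0 r ∈ map (φ k) (𝓝[>] 0) := image_mem_map h.Ioo_mem
    have hA' := hA
    rw [← hmap] at hA'
    filter_upwards [hA, mem_map.1 hA']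
    rintro _ ⟨t, ht, rfl⟩ ⟨s, hs, hst⟩
    -- The parameter on the branch is the distance to the fixed point `p`, which `ι` preserves.
    have e := ι.edist_apply (φ k t) p
    rw [← hst, hp, h.edist_center k ⟨hs.1.le, hs.2⟩, h.edist_center k ⟨ht.1.le, ht.2⟩,
      ENNReal.ofReal_eq_ofReal_iff hs.1.le ht.1.le] at e
    show ι.toHomeomorph _ = _
    rw [← hst, e]
  · rw [h.directions_top, Finset.mem_singleton] at hd
    rw [hd]
    exact ι.eventually_fixed_of_end h hp

/-- The direction and its image are disjoint filters, so points close to `p` along it are moved. -/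
theorem compl_realLocus_mem_of_map_ne (hT : IsStarOrEnd T) (hp : p ∈ ι.realLocus)
    (hd : d ∈ directions p) (hmap : map ι.toHomeomorph d ≠ d) : ι.realLocusᶜ ∈ d := by
  have hp : ι.toHomeomorph p = p := hp
  have hd' := ι.map_mem_directions hT hd
  rw [hp] at hd'
  obtain ⟨V, hV, W, hW, hVW⟩ := Filter.disjoint_iff.1 (hT.disjoint hd' hd hmap)
  filter_upwards [mem_map.1 hV, hW] with x hxV hxW hx
  have hx : ι.toHomeomorph x = x := hx
  exact Set.disjoint_left.1 hVW hxV (hx.symm ▸ hxW)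

theorem isClosed_realLocus : IsClosed ι.realLocus :=
  isClosed_eq ι.toHomeomorph.continuous continuous_id

end RealStructure

variable [T2Space T] {p : T} {d : Filter T}

/-- A short half-open arc from `p` along `d` lies in `F` and is connected. -/
theorem IsStarOrEnd.connectedComponentIn_mem (hT : IsStarOrEnd T) {F : Set T} (hp : p ∈ F)
    (hd : d ∈ directions p) (hF : F ∈ d) : connectedComponentIn F p ∈ d := by
  rcases hT p with ⟨n, r, φ, h⟩ | ⟨φ, h, rfl⟩
  · obtain ⟨k, rfl⟩ := h.mem_directions_iff.1 hd
    obtain ⟨b, hb, -, harc⟩ := h.exists_isArc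
    obtain ⟨ε, ⟨hε, hεb⟩, hsub⟩ := (mem_nhdsGT_iff_exists_mem_Ioc_Ioo_subset hb).1 (mem_map.1 hF)
    have hpre : IsPreconnected (φ k '' Set.Ico 0 ε) :=
      isPreconnected_Ico.image _ ((harc k).continuousOn.mono fun t ht => ⟨ht.1, ht.2.le.trans hεb⟩)
    have hcomp := hpre.subset_connectedComponentIn (x := p) (F := F)
      ⟨0, ⟨le_rfl, hε⟩, h.center k⟩ (by
        rintro _ ⟨t, ht, rfl⟩
        rcases eq_or_lt_of_le ht.1 with rfl | h0
        · rwa [h.center]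
        · exact hsub ⟨h0, ht.2⟩)
    exact mem_of_superset (image_mem_map (Ioo_mem_nhdsGT hε))
      ((Set.image_mono Set.Ioo_subset_Ico_self).trans hcomp)
  · rw [h.directions_top, Finset.mem_singleton] at hd
    rw [hd, ← h.map_nhdsNE_top, ← Set.Iio_top] at hF ⊢
    obtain ⟨R, ⟨-, hR⟩, hsub⟩ :=
      (mem_nhdsLT_iff_exists_mem_Ico_Ioo_subset ENNReal.zero_lt_top).1 (mem_map.1 hF)
    have hcomp := (isPreconnected_Ioc.image φ h.continuous.continuousOn).subset_connectedComponentIn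
      (x := φ ∞) (F := F) ⟨∞, ⟨hR, le_rfl⟩, rfl⟩ (by
        rintro _ ⟨t, ht, rfl⟩
        rcases eq_or_lt_of_le ht.2 with rfl | h0
        · exact hp
        · exact hsub ⟨ht.1, h0⟩)
    exact mem_of_superset (image_mem_map (Ioo_mem_nhdsLT hR))
      ((Set.image_mono Set.Ioo_subset_Ioc_self).trans hcomp)

namespace RealStructure

variable {C : Set T}

/-- A direction is either contained in a real component, emanates from it, and is preserved by
the real structure, or avoids the component, and is not preserved if it emanates from it. -/
theorem mem_or_compl_mem (hT : IsStarOrEnd T) (hC : ι.IsRealComponent C) (hd : d ∈ directions p) :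
    (p ∈ C ∧ map ι.toHomeomorph d = d ∧ C ∈ d) ∨
      ((p ∈ C → map ι.toHomeomorph d ≠ d) ∧ Cᶜ ∈ d) := by
  obtain ⟨x, hx, rfl⟩ := hC
  have hsub := connectedComponentIn_subset ι.realLocus x
  by_cases hp : p ∈ ι.realLocus
  · by_cases hmap : map ι.toHomeomorph d = d
    · have hmem := hT.connectedComponentIn_mem hp hd (ι.realLocus_mem_of_map_eq hT hp hd hmap)
      by_cases hpC : p ∈ connectedComponentIn ι.realLocus x
      · exact Or.inl ⟨hpC, hmap, by rwa [connectedComponentIn_eq hpC]⟩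
      · refine Or.inr ⟨fun h => absurd h hpC, ?_⟩
        filter_upwards [hmem] with y hy hy'
        rw [connectedComponentIn_eq hy', ← connectedComponentIn_eq hy] at hpC
        exact hpC (mem_connectedComponentIn hp)
    · exact Or.inr ⟨fun _ => hmap, mem_of_superset
        (ι.compl_realLocus_mem_of_map_ne hT hp hd hmap) (Set.compl_subset_compl.2 hsub)⟩
  · exact Or.inr ⟨fun h => absurd (hsub h) hp, hT.le_nhds hd (mem_of_superset
      (ι.isClosed_realLocus.isOpen_compl.mem_nhds hp) (Set.compl_subset_compl.2 hsub))⟩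

theorem IsRealComponent.isTame (hT : IsStarOrEnd T) (hC : ι.IsRealComponent C) : IsTame C :=
  fun _ _ hd => (ι.mem_or_compl_mem hT hC hd).imp (fun h => h.2.2) And.right

theorem IsRealComponent.flux_eq_zero (hT : IsStarOrEnd T) (hC : ι.IsRealComponent C) {g : T → ℝ}
    (hp : p ∉ C) : flux g C p = 0 :=
  RealTropical.flux_eq_zero fun _ hd h =>
    (ι.mem_or_compl_mem hT hC hd).elim (fun h' => hp h'.1)
      fun h' => hT.notMem_of_disjoint hd disjoint_compl_left h'.2 h

/-- The directions leaving a real component are exchanged in pairs by the real structure. -/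
theorem IsRealComponent.cast_flux_eq (hT : IsStarOrEnd T) (hC : ι.IsRealComponent C) {g : T → ℝ}
    (hg : ∀ d ∈ directions p, germSlope g (map ι.toHomeomorph d) = germSlope g d) (hp : p ∈ C) :
    (flux g C p : ZMod 2) = ((∑ d ∈ directions p, germSlope g d : ℤ) : ZMod 2) := by
  classical
  have hfix : ι.toHomeomorph p = p := by
    obtain ⟨x, hx, rfl⟩ := hC
    exact connectedComponentIn_subset ι.realLocus x hp
  have hι : ∀ d ∈ directions p, map ι.toHomeomorph d ∈ directions p := fun d hd => by
    have := ι.map_mem_directions hT hd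
    rwa [hfix] at this
  have hmem : ∀ d ∈ directions p, C ∈ d ↔ map ι.toHomeomorph d = d := fun d hd => by
    rcases ι.mem_or_compl_mem hT hC hd with h | h
    · exact iff_of_true h.2.2 h.2.1
    · exact iff_of_false (hT.notMem_of_disjoint hd disjoint_compl_left h.2) (h.1 hp)
  -- The directions not in `C` are moved by `ι` to directions of equal slope, and each pair sums to
  -- zero modulo 2.
  have key : ∑ d ∈ directions p, ((if C ∈ d then 0 else germSlope g d : ℤ) : ZMod 2) = 0 := by
    refine Finset.sum_involution (fun d _ => map ι.toHomeomorph d) (fun d hd => ?_)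
      (fun d hd h0 h1 => ?_) hι (fun d _ => ι.map_map_self d)
    · rw [hg d hd, if_congr (hmem _ (hι d hd)) rfl rfl, if_congr (hmem d hd) rfl rfl,
        ι.map_map_self]
      rw [if_congr (eq_comm (a := d)) rfl rfl]
      exact CharTwo.add_self_eq_zero _
    · rw [if_pos ((hmem d hd).2 h1)] at h0
      simp at h0
  rw [← sub_eq_zero, ← neg_eq_zero, neg_sub, ← key, flux, ← Int.cast_sub,
    ← Finset.sum_sub_distrib, Int.cast_sum]
  refine Finset.sum_congr rfl fun d _ => ?_
  split_ifs <;> simp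

end RealStructure

end RealStructures

theorem isStarOrEnd_and_t2Space {T : Type*} [TopologicalSpace T] [WeakEMetricSpace T]
    (hT : IsMetricGraph T ∨ IsTropicalCurve T) :
    IsStarOrEnd T ∧ T2Space T ∧ CompactSpace T ∧ ConnectedSpace T := by
  rcases hT with h | h
  · exact ⟨fun p => Or.inl (h.star p), t2Space_of_edist_ne_top h.edist_ne_top, h.compact,
      h.connected⟩
  · exact ⟨h.star_or_end, h.hausdorff, h.compact, h.connected⟩

open Classical in
theorem degreeOn_eq_sum {T : Type*} (D : Divisor T) (C : Set T) {W : Finset T}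
    (hW : D.support ⊆ W) : degreeOn D C = ∑ p ∈ W, if p ∈ C then D p else 0 := by
  rw [degreeOn, Finset.sum_filter]
  refine Finset.sum_subset hW fun p _ hp => ?_
  rw [Finsupp.notMem_support_iff.1 hp, ite_self]

end RealTropical

theorem theorem4 {T : Type*} [TopologicalSpace T] [WeakEMetricSpace T]
    (hT : IsMetricGraph T ∨ IsTropicalCurve T) (ι : RealStructure T)
    (D₁ D₂ : Divisor T) (hD₁ : ι.IsRealDivisor D₁) (hD₂ : ι.IsRealDivisor D₂)
    (h : LinearlyEquivalent D₁ D₂) (C : Set T) (hC : ι.IsRealComponent C) :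
    degreeOn D₁ C ≡ degreeOn D₂ C [ZMOD 2] := by
  classical
  obtain ⟨hT, _, _, _⟩ := isStarOrEnd_and_t2Space hT
  obtain ⟨f, hf, hΔ⟩ := h
  have hg := hf.isStarAffine hT
  have hsum := fun p => (hΔ p).sum_germSlope hT
  have hinv := ι.eventually_eq_comp hT hg fun p => by rw [hsum, hsum, hD₁ p, hD₂ p]
  have hslope : ∀ p, ∀ d ∈ directions p,
      germSlope (fun x => (f x).toReal) (map ι.toHomeomorph d) =
        germSlope (fun x => (f x).toReal) d := by
    intro p d hd
    obtain ⟨m, hm, -⟩ := hg p d hd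
    have hm' := hm.congr (hT.le_nhdsNE hd (hinv p))
    rw [hm.germSlope_eq hT hd, (ι.hasGermSlope_comp_iff.1 hm').germSlope_eq hT
      (ι.map_mem_directions hT hd)]
  obtain ⟨hfin, hzero⟩ := hT.isBalanced hg.isPiecewiseAffine
    (RealStructure.IsRealComponent.isTame ι hT hC)
  -- A common finite index set for both degrees and for the total flux, so that they can be compared
  -- point by point.
  set W := D₁.support ∪ D₂.support ∪ hfin.toFinset
  rw [finsum_eq_sum_of_support_subset _ (s := W) (fun p hp =>
    Finset.mem_coe.2 (Finset.mem_union_right _ (hfin.mem_toFinset.2 hp)))] at hzero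
  replace hzero := congrArg (Int.cast : ℤ → ZMod 2) hzero
  rw [Int.cast_sum, Int.cast_zero] at hzero
  have h₁ : D₁.support ⊆ W := Finset.subset_union_left.trans Finset.subset_union_left
  have h₂ : D₂.support ⊆ W := Finset.subset_union_right.trans Finset.subset_union_left
  refine ((ZMod.intCast_eq_intCast_iff _ _ 2).1 ?_)
  rw [eq_comm, ← sub_eq_zero, ← Int.cast_sub, degreeOn_eq_sum D₁ C h₁, degreeOn_eq_sum D₂ C h₂,
    ← Finset.sum_sub_distrib, Int.cast_sum, ← hzero]
  refine Finset.sum_congr rfl fun p _ => ?_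
  by_cases hp : p ∈ C
  · rw [RealStructure.IsRealComponent.cast_flux_eq ι hT hC (hslope p) hp, hsum, if_pos hp,
      if_pos hp]
  · rw [RealStructure.IsRealComponent.flux_eq_zero ι hT hC hp, if_neg hp, if_neg hp, sub_zero]
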